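/- Let $d\ge 1$ and let $K\subset\mathbb{R}^d$ be a convex body, i.e. a compact convex set with non-empty interior, with Lebesgue volume $|K|$ and diameter $D(K)$. Let $\psi_{\rho_K}(z)=\frac{d}{dz}\mathbb{P}(\rho_K\le z)$ be the probability density of $\rho_K=\|P_1-P_2\|$, where $P_1,P_2$ are independent and uniformly distributed in $K$. Let $\phi$ and $\Phi$ be the standard normal density and distribution function. Condition 1. $Z=\{Z(x,t),\ x\in\mathbb{R}^d,\ t\in\mathbb{R}\}$ is a real-valued, (jointly) measurable, mean-square continuous Gaussian random field, homogeneous and isotropic in space and stationary in time, with $\mathbb{E}[Z(x,t)]=0$, $\mathbb{E}[Z^2(x,t)]=1$ and covariance function $$C(\|x-y\|,|t-s|)=\mathbb{E}[Z(x,t)Z(y,s)]\ge 0\qquad\text{for all } x,y\in\mathbb{R}^d,\ t,s\in\mathbb{R}.$$ Condition 2 (with $m=1$). (i) $\sup_{z\in[0,D(K)]}|C(z,\tau)|\to 0$ as $\tau\to\infty$; (ii) there is $\delta\in(0,1)$ such that $$\lim_{T\to\infty}\frac{1}{T^{\delta}}\int_0^T\Big(1-\frac{\tau}{T}\Big)\int_0^{D(K)}C(z,\tau)\,\psi_{\rho_K}(z)\,dz\,d\tau=\infty.$$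 For $u\in\mathbb{R}$ and $T>0$ let $$M_T^{(1)}(u)=\big|\{(x,t)\in K\times[0,T]:\ Z(x,t)\ge u\}\big|,$$ $$\sigma_{1,K}(T)=\Big[2T|K|^2\int_0^T\Big(1-\frac{\tau}{T}\Big)\int_0^{D(K)}C(z,\tau)\,\psi_{\rho_K}(z)\,dz\,d\tau\Big]^{1/2}.$$ Theorem. Under Conditions 1 and 2 with $m=1$, for every $u\in\mathbb{R}$ the random variables $$\frac{M_T^{(1)}(u)-T|K|(1-\Phi(u))}{\phi(u)\,\sigma_{1,K}(T)}\qquad\text{and}\qquad\frac{\int_0^T\int_K Z(x,t)\,dx\,dt}{\sigma_{1,K}(T)}$$ have the same limit in distribution as $T\to\infty$, namely the standard normal distribution. -/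

import Mathlib

open MeasureTheory ProbabilityTheory Filter Set
open scoped Topology

noncomputable section

namespace SpaceTimeField

/-- The `d`-dimensional Euclidean space. -/
abbrev Space (d : ℕ) : Type := EuclideanSpace ℝ (Fin d)

/-- A convex body: a compact convex set with non-empty interior. -/
structure IsConvexBody {d : ℕ} (K : Set (Space d)) : Prop where
  isCompact : IsCompact K
  convex : Convex ℝ K
  nonempty_interior : (interior K).Nonempty

/-- The joint law of two independent points, each uniformly distributed in `K`
(`cond volume K` is normalized Lebesgue measure on `K`). -/
def twoPointLaw {d : ℕ} (K : Set (Space d)) : Measure (Space d × Space d) :=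
  (cond volume K).prod (cond volume K)

/-- The distribution function `r ↦ ℙ(ρ_K ≤ r)` of the distance `ρ_K = ‖P₁ - P₂‖` between two
independent uniform random points of `K`. -/
def distanceCDF {d : ℕ} (K : Set (Space d)) (r : ℝ) : ℝ :=
  (twoPointLaw K).real {p | ‖p.1 - p.2‖ ≤ r}

/-- The probability density `ψ_{ρ_K}` of `ρ_K`, as the derivative of its distribution function. -/
def distanceDensity {d : ℕ} (K : Set (Space d)) (z : ℝ) : ℝ :=
  deriv (distanceCDF K) z

/-- `Z` is a jointly measurable, mean-square continuous, centred Gaussian random field on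
`ℝ^d × ℝ` with unit variance, homogeneous and isotropic in space and stationary in time, with
non-negative covariance function `C`, that is, `E[Z(x,t) Z(y,s)] = C(‖x - y‖, |t - s|) ≥ 0`.
(The law of a centred Gaussian field is determined by its covariance function, so this form of
the covariance expresses homogeneity, isotropy and stationarity.) -/
structure Condition1 {d : ℕ} {Ω : Type*} [MeasurableSpace Ω] (P : Measure Ω)
    (Z : Space d × ℝ → Ω → ℝ) (C : ℝ → ℝ → ℝ) : Prop where
  measurable : Measurable (fun q : (Space d × ℝ) × Ω => Z q.1 q.2)
  meanSquareContinuous : ∀ p₀ : Space d × ℝ,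
    Tendsto (fun p => ∫ ω, (Z p ω - Z p₀ ω) ^ 2 ∂P) (𝓝 p₀) (𝓝 0)
  gaussian : IsGaussianProcess Z P
  mean_zero : ∀ p, ∫ ω, Z p ω ∂P = 0
  unit_variance : ∀ p, ∫ ω, Z p ω ^ 2 ∂P = 1
  covariance : ∀ (x y : Space d) (t s : ℝ),
    ∫ ω, Z (x, t) ω * Z (y, s) ω ∂P = C ‖x - y‖ |t - s|
  covariance_nonneg : ∀ (x y : Space d) (t s : ℝ), 0 ≤ ∫ ω, Z (x, t) ω * Z (y, s) ω ∂P

/-- `∫₀ᵀ (1 - τ/T) ∫₀^{D(K)} C^m(z,τ) ψ_{ρ_K}(z) dz dτ`, where `D(K)` is the diameter of `K`. -/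
def covIntegral {d : ℕ} (K : Set (Space d)) (C : ℝ → ℝ → ℝ) (m : ℕ) (T : ℝ) : ℝ :=
  ∫ τ in (0 : ℝ)..T, (1 - τ / T) *
    ∫ z in (0 : ℝ)..Metric.diam K, C z τ ^ m * distanceDensity K z

/-- The decay and long-range dependence conditions on the covariance function `C`. -/
structure Condition2 {d : ℕ} (K : Set (Space d)) (C : ℝ → ℝ → ℝ) (m : ℕ) : Prop where
  /-- `sup_{z ∈ [0, D(K)]} |C(z,τ)| → 0` as `τ → ∞`. -/
  decay : Tendsto (fun τ => sSup ((fun z => |C z τ|) '' Icc 0 (Metric.diam K))) atTop (𝓝 0)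
  /-- For some `δ ∈ (0,1)`, `T^{-δ}` times the covariance integral tends to infinity. -/
  longRange : ∃ δ ∈ Ioo (0 : ℝ) 1,
    Tendsto (fun T : ℝ => 1 / T ^ δ * covIntegral K C m T) atTop atTop

/-- The sojourn functional `M_T^{(1)}(u) = |{(x,t) ∈ K × [0,T] : Z(x,t) ≥ u}|`. -/
def excursionVolume {d : ℕ} {Ω : Type*} (Z : Space d × ℝ → Ω → ℝ) (K : Set (Space d))
    (u T : ℝ) (ω : Ω) : ℝ :=
  (volume : Measure (Space d × ℝ)).real {p | p.1 ∈ K ∧ 0 ≤ p.2 ∧ p.2 ≤ T ∧ u ≤ Z p ω}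

/-- The standard deviation `σ_{1,K}(T)` of `∫₀ᵀ ∫_K Z(x,t) dx dt`, in the form
`[2 T |K|² ∫₀ᵀ (1 - τ/T) ∫₀^{D(K)} C(z,τ) ψ_{ρ_K}(z) dz dτ]^{1/2}`. -/
def sigmaOne {d : ℕ} (K : Set (Space d)) (C : ℝ → ℝ → ℝ) (T : ℝ) : ℝ :=
  Real.sqrt (2 * T * volume.real K ^ 2 * covIntegral K C 1 T)

/-- The normalized sojourn functional
`(M_T^{(1)}(u) - T |K| (1 - Φ(u))) / (φ(u) σ_{1,K}(T))`. -/
def normalizedExcursion {d : ℕ} {Ω : Type*} (Z : Space d × ℝ → Ω → ℝ) (K : Set (Space d))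
    (C : ℝ → ℝ → ℝ) (u T : ℝ) (ω : Ω) : ℝ :=
  (excursionVolume Z K u T ω - T * volume.real K * (1 - cdf (gaussianReal 0 1) u)) /
    (gaussianPDFReal 0 1 u * sigmaOne K C T)

/-- The normalized integral `(∫₀ᵀ ∫_K Z(x,t) dx dt) / σ_{1,K}(T)`. -/
def normalizedIntegral {d : ℕ} {Ω : Type*} (Z : Space d × ℝ → Ω → ℝ) (K : Set (Space d))
    (C : ℝ → ℝ → ℝ) (T : ℝ) (ω : Ω) : ℝ :=
  (∫ t in (0 : ℝ)..T, ∫ x in K, Z (x, t) ω) / sigmaOne K C T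

end SpaceTimeField

end

/-! Split the indicator of `[u, ∞)` along Hermite polynomials: it equals `1 - Φ(u)`, plus `φ(u) z`,
plus a remainder that is orthogonal to constants and to `z` under the standard normal law.
Integrated over the window `K × [0, T]`, the constant gives the mean of the sojourn volume and the
linear term gives `φ(u)` times the integral of the field. It remains to see that this integral is
Gaussian with variance `σ²` and that the remainder is negligible in `L²` after division by `σ`.

The integral of the field lies in the closed linear span of the field, so its law is exactly centred
Gaussian (`map_field_integral_eq_gaussianReal`). Its variance is the double integral of the
covariance, which polar coordinates and the time-lag formula turn into `σ²`
(`integral_windowMeasure_prod`). The normalized integral is thus standard normal as soon as `σ > 0`.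

For the remainder, `abs_integral_excursionRemainder_mul_le` bounds its covariance at two points with
correlation `r ≥ 0` by a constant times `r²`. This replaces the full Hermite expansion: write `Y = r
X + √(1 - r²) W` with `W` independent of `X`, average over `W`, and Taylor expand `Φ`. The variance
of the integrated remainder is then at most a constant times the double integral of `C²`. Beyond a
lag `b` one has `C² ≤ ε C`; shorter lags contribute at most `2 T |K|² b`, which is negligible
because the covariance integral diverges. Slutsky's lemma concludes. -/

noncomputable section

namespace SpaceTimeField

/-! ### Gaussian laws in the closed span of a Gaussian process -/

section GaussianClosure

variable {Ω T : Type*} [MeasurableSpace Ω] {P : Measure Ω}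

theorem memLp_two_of_isGaussianProcess {X : T → Ω → ℝ} (hX : IsGaussianProcess X P) (t : T) :
    MemLp (X t) 2 P :=
  (hX.hasGaussianLaw_eval t).memLp_two

/-- Random variables in the linear span of a centred Gaussian process are centred Gaussian. -/
theorem map_eq_gaussianReal_of_mem_span [IsProbabilityMeasure P]
    {X : T → Ω → ℝ} (hX : IsGaussianProcess X P)
    (h0 : ∀ t, ∫ ω, X t ω ∂P = 0) {f : Lp ℝ 2 P}
    (hf : f ∈ Submodule.span ℝ
      (range fun t => (memLp_two_of_isGaussianProcess hX t).toLp (X t))) :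
    P.map f = gaussianReal 0 (∫ ω, f ω ^ 2 ∂P).toNNReal := by
  obtain ⟨c, rfl⟩ := Finsupp.mem_span_range_iff_exists_finsupp.1 hf
  set g : Lp ℝ 2 P :=
    c.sum fun t a => a • (memLp_two_of_isGaussianProcess hX t).toLp (X t) with hg
  have hae : (fun ω => ∑ t ∈ c.support, c t • X t ω) =ᵐ[P] g := by
    have h1 : g =ᵐ[P] fun ω => ∑ t ∈ c.support,
        (c t • (memLp_two_of_isGaussianProcess hX t).toLp (X t) : Lp ℝ 2 P) ω := by
      rw [hg, Finsupp.sum]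
      exact Lp.coeFn_fun_finsetSum _ _
    have h2 : ∀ᵐ ω ∂P, ∀ t ∈ c.support,
        (c t • (memLp_two_of_isGaussianProcess hX t).toLp (X t) : Lp ℝ 2 P) ω = c t • X t ω := by
      rw [Finset.eventually_all]
      intro t _
      filter_upwards [Lp.coeFn_smul (c t) ((memLp_two_of_isGaussianProcess hX t).toLp (X t)),
        (memLp_two_of_isGaussianProcess hX t).coeFn_toLp] with ω h3 h4
      rw [h3, Pi.smul_apply, h4]
    filter_upwards [h1, h2] with ω h3 h4
    rw [h3]
    exact (Finset.sum_congr rfl h4).symm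
  have hG : HasGaussianLaw (fun ω => ∑ t ∈ c.support, c t • X t ω) P :=
    (hX.smul c).hasGaussianLaw_fun_sum
  have hG' : HasGaussianLaw g P := hG.congr hae
  have hmean : ∫ ω, g ω ∂P = 0 := by
    rw [← integral_congr_ae hae, integral_finsetSum]
    · simp [integral_const_mul, h0]
    · intro t _
      exact ((hX.hasGaussianLaw_eval t).integrable).smul (c t)
  rw [hG'.map_eq_gaussianReal, hmean, variance_of_integral_eq_zero hG'.aemeasurable hmean]

/-- Random variables in the `L²`-closed linear span of a centred Gaussian process are centred
Gaussian. -/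
theorem map_eq_gaussianReal_of_mem_closure_span [IsProbabilityMeasure P]
    {X : T → Ω → ℝ} (hX : IsGaussianProcess X P)
    (h0 : ∀ t, ∫ ω, X t ω ∂P = 0) {f : Lp ℝ 2 P}
    (hf : f ∈ (Submodule.span ℝ
      (range fun t => (memLp_two_of_isGaussianProcess hX t).toLp (X t))).topologicalClosure) :
    P.map f = gaussianReal 0 (∫ ω, f ω ^ 2 ∂P).toNNReal := by
  have hsq (g : Lp ℝ 2 P) : ∫ ω, g ω ^ 2 ∂P = ‖g‖ ^ 2 := by
    rw [← real_inner_self_eq_norm_sq, L2.inner_def]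
    simp [sq]
  have hf' := (mem_closure_iff_seq_limit.1 hf)
  obtain ⟨g, hg, hlim⟩ := hf'
  have hdist : TendstoInDistribution (fun n => (g n : Ω → ℝ)) atTop (f : Ω → ℝ) (fun _ => P) P :=
    (tendstoInMeasure_of_tendsto_Lp hlim).tendstoInDistribution
      fun n => (Lp.aestronglyMeasurable (g n)).aemeasurable
  have : IsProbabilityMeasure (P.map f) :=
    Measure.isProbabilityMeasure_map (Lp.aestronglyMeasurable f).aemeasurable
  apply Measure.ext_of_charFun
  ext t
  have h1 := (ProbabilityMeasure.tendsto_iff_tendsto_charFun.1 hdist.tendsto) t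
  simp only [ProbabilityMeasure.coe_mk] at h1
  refine tendsto_nhds_unique h1 ?_
  -- A centred Gaussian law depends only on its variance, here the squared `L²` norm, which is
  -- continuous along the sequence; so the characteristic functions converge to the Gaussian one.
  have h2 (n : ℕ) : charFun (P.map (g n)) t =
      Complex.exp (-(((‖g n‖ ^ 2 : ℝ) : ℂ) * t ^ 2 / 2)) := by
    rw [map_eq_gaussianReal_of_mem_span hX h0 (hg n), charFun_gaussianReal, hsq,
      Real.coe_toNNReal _ (by positivity)]
    congr 1
    push_cast
    ring
  simp only [h2]
  rw [charFun_gaussianReal, hsq, Real.coe_toNNReal _ (by positivity)]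
  have h3 : Complex.exp (t * ((0 : ℝ) : ℂ) * Complex.I - ((‖f‖ ^ 2 : ℝ) : ℂ) * t ^ 2 / 2) =
      Complex.exp (-(((‖f‖ ^ 2 : ℝ) : ℂ) * t ^ 2 / 2)) := by
    congr 1
    push_cast
    ring
  rw [h3]
  have h4 : Continuous fun r : ℝ => Complex.exp (-((r : ℂ) * t ^ 2 / 2)) := by fun_prop
  exact (h4.tendsto _).comp ((hlim.norm).pow 2)

end GaussianClosure

/-! ### Second moments and laws of integrated random fields -/

theorem sq_integral_eq_integral_prod {Ω S : Type*} [MeasurableSpace S] {μ : Measure S} [SFinite μ] 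
    {F : S → Ω → ℝ} (ω : Ω) :
    (∫ p, F p ω ∂μ) ^ 2 = ∫ p : S × S, F p.1 ω * F p.2 ω ∂(μ.prod μ) := by
  -- No integrability is needed: the product formula also holds when both sides take the default
  -- value zero. The identity can therefore be used for every `ω`, not just almost every one.
  rw [sq, integral_prod_mul (fun p => F p ω) (fun p => F p ω)]

section SecondMoment


variable {Ω S : Type*} [MeasurableSpace Ω] [MeasurableSpace S] {P : Measure Ω}
  {μ : Measure S}

theorem integrable_mul_of_integrable_sq {f g : Ω → ℝ} (hf : AEStronglyMeasurable f P)
    (hg : AEStronglyMeasurable g P) (hf2 : Integrable (fun ω => f ω ^ 2) P)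
    (hg2 : Integrable (fun ω => g ω ^ 2) P) : Integrable (fun ω => f ω * g ω) P :=
  ((memLp_two_iff_integrable_sq hf).2 hf2).integrable_mul ((memLp_two_iff_integrable_sq hg).2 hg2)

theorem integral_abs_mul_le {f g : Ω → ℝ} (hf : AEStronglyMeasurable f P)
    (hg : AEStronglyMeasurable g P) (hf2 : Integrable (fun ω => f ω ^ 2) P)
    (hg2 : Integrable (fun ω => g ω ^ 2) P) {M : ℝ} (hfM : ∫ ω, f ω ^ 2 ∂P ≤ M)
    (hgM : ∫ ω, g ω ^ 2 ∂P ≤ M) : ∫ ω, |f ω * g ω| ∂P ≤ M := by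
  have h : ∫ ω, |f ω * g ω| ∂P ≤ ∫ ω, (f ω ^ 2 + g ω ^ 2) / 2 ∂P := by
    apply integral_mono (integrable_mul_of_integrable_sq hf hg hf2 hg2).abs
      ((hf2.add hg2).div_const 2)
    intro ω
    simp only [abs_mul, Pi.add_apply]
    nlinarith [sq_nonneg (|f ω| - |g ω|), sq_abs (f ω), sq_abs (g ω)]
  rw [integral_div, integral_add hf2 hg2] at h
  linarith

variable [IsProbabilityMeasure P] [IsFiniteMeasure μ]

/-- A jointly measurable field with uniformly bounded second moments has integrable products. -/
theorem integrable_field_mul {F : S → Ω → ℝ} (hF : Measurable fun q : S × Ω => F q.1 q.2)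
    (hF2 : ∀ p, Integrable (fun ω => F p ω ^ 2) P) {M : ℝ} (hM : ∀ p, ∫ ω, F p ω ^ 2 ∂P ≤ M) :
    Integrable (fun q : (S × S) × Ω => F q.1.1 q.2 * F q.1.2 q.2) ((μ.prod μ).prod P) := by
  have hm (p : S) : AEStronglyMeasurable (F p) P :=
    (hF.comp (measurable_const.prodMk measurable_id)).aestronglyMeasurable
  have hmeas : Measurable (fun q : (S × S) × Ω => F q.1.1 q.2 * F q.1.2 q.2) :=
    (hF.comp ((measurable_fst.comp measurable_fst).prodMk measurable_snd)).mul
      (hF.comp ((measurable_snd.comp measurable_fst).prodMk measurable_snd))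
  rw [integrable_prod_iff hmeas.aestronglyMeasurable]
  refine ⟨ae_of_all _ fun p => integrable_mul_of_integrable_sq (hm p.1) (hm p.2)
    (hF2 p.1) (hF2 p.2), ?_⟩
  refine Integrable.of_bound
    hmeas.norm.stronglyMeasurable.integral_prod_right.aestronglyMeasurable M
    (ae_of_all _ fun p => ?_)
  rw [Real.norm_of_nonneg (integral_nonneg fun _ => norm_nonneg _)]
  exact integral_abs_mul_le (hm p.1) (hm p.2) (hF2 p.1) (hF2 p.2) (hM p.1) (hM p.2)

theorem integrable_field {F : S → Ω → ℝ} (hF : Measurable fun q : S × Ω => F q.1 q.2)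
    (hF2 : ∀ p, Integrable (fun ω => F p ω ^ 2) P) {M : ℝ} (hM : ∀ p, ∫ ω, F p ω ^ 2 ∂P ≤ M) :
    Integrable (fun q : S × Ω => F q.1 q.2) (μ.prod P) := by
  have hm (p : S) : AEStronglyMeasurable (F p) P :=
    (hF.comp (measurable_const.prodMk measurable_id)).aestronglyMeasurable
  rw [integrable_prod_iff hF.aestronglyMeasurable]
  have h1 (p : S) : Integrable (F p) P :=
    ((memLp_two_iff_integrable_sq (hm p)).2 (hF2 p)).integrable (by norm_num)
  refine ⟨ae_of_all _ fun p => h1 p, ?_⟩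
  refine Integrable.of_bound
    hF.norm.stronglyMeasurable.integral_prod_right.aestronglyMeasurable (M + 1)
    (ae_of_all _ fun p => ?_)
  rw [Real.norm_of_nonneg (integral_nonneg fun _ => norm_nonneg _)]
  calc ∫ ω, ‖F p ω‖ ∂P ≤ ∫ ω, (F p ω ^ 2 + 1) ∂P := by
        apply integral_mono (h1 p).norm ((hF2 p).add (integrable_const _))
        intro ω
        simp only [Real.norm_eq_abs, Pi.add_apply]
        nlinarith [sq_nonneg (|F p ω| - 1), sq_abs (F p ω), abs_nonneg (F p ω)]
    _ ≤ M + 1 := by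
        rw [integral_add (hF2 p) (integrable_const _)]
        simpa using hM p

theorem measurable_field_integral {F : S → Ω → ℝ} (hF : Measurable fun q : S × Ω => F q.1 q.2) :
    Measurable fun ω => ∫ p, F p ω ∂μ :=
  (StronglyMeasurable.integral_prod_left (f := F) (μ := μ) hF.stronglyMeasurable).measurable

theorem integrable_sq_field_integral {F : S → Ω → ℝ} (hF : Measurable fun q : S × Ω => F q.1 q.2)
    (hF2 : ∀ p, Integrable (fun ω => F p ω ^ 2) P) {M : ℝ} (hM : ∀ p, ∫ ω, F p ω ^ 2 ∂P ≤ M) :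
    Integrable (fun ω => (∫ p, F p ω ∂μ) ^ 2) P := by
  simp only [sq_integral_eq_integral_prod]
  exact (integrable_field_mul (μ := μ) hF hF2 hM).integral_prod_right

/-- The second moment of the integral of a random field. -/
theorem integral_sq_field_integral {F : S → Ω → ℝ} (hF : Measurable fun q : S × Ω => F q.1 q.2)
    (hF2 : ∀ p, Integrable (fun ω => F p ω ^ 2) P) {M : ℝ} (hM : ∀ p, ∫ ω, F p ω ^ 2 ∂P ≤ M) :
    ∫ ω, (∫ p, F p ω ∂μ) ^ 2 ∂P =
      ∫ p : S × S, (∫ ω, F p.1 ω * F p.2 ω ∂P) ∂(μ.prod μ) := by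
  simp only [sq_integral_eq_integral_prod]
  exact (integral_integral_swap (integrable_field_mul (μ := μ) hF hF2 hM)).symm

/-- The integral of a jointly measurable centred Gaussian field is centred Gaussian. -/
theorem map_field_integral_eq_gaussianReal {Z : S → Ω → ℝ}
    (hZ : Measurable fun q : S × Ω => Z q.1 q.2) (hG : IsGaussianProcess Z P)
    (h0 : ∀ p, ∫ ω, Z p ω ∂P = 0) {M : ℝ} (hM : ∀ p, ∫ ω, Z p ω ^ 2 ∂P ≤ M) :
    P.map (fun ω => ∫ p, Z p ω ∂μ) =
      gaussianReal 0 (∫ ω, (∫ p, Z p ω ∂μ) ^ 2 ∂P).toNNReal := by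
  have hZ2 (p : S) : Integrable (fun ω => Z p ω ^ 2) P :=
    (memLp_two_of_isGaussianProcess hG p).integrable_sq
  have hI : MemLp (fun ω => ∫ p, Z p ω ∂μ) 2 P :=
    (memLp_two_iff_integrable_sq (measurable_field_integral hZ).aestronglyMeasurable).2
      (integrable_sq_field_integral hZ hZ2 hM)
  have hmem : hI.toLp _ ∈ (Submodule.span ℝ
      (range fun t => (memLp_two_of_isGaussianProcess hG t).toLp (Z t))).topologicalClosure := by
    -- By Fubini, whatever is orthogonal to every `Z p` is orthogonal to the integral; the double
    -- orthogonal complement then gives membership in the closure without approximation by Riemann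
    -- sums.
    rw [← Submodule.orthogonal_orthogonal_eq_closure, Submodule.mem_orthogonal]
    intro g hg
    have hgm := (Lp.stronglyMeasurable g).measurable
    have hg2 : Integrable (fun ω => g ω ^ 2) P := (Lp.memLp g).integrable_sq
    have hgp (p : S) : ∫ ω, g ω * Z p ω ∂P = 0 := by
      have h1 := (Submodule.mem_orthogonal _ _).1 hg _
        (Submodule.subset_span (mem_range_self p))
      rw [L2.inner_def] at h1
      rw [← h1]
      refine integral_congr_ae ?_
      filter_upwards [(memLp_two_of_isGaussianProcess hG p).coeFn_toLp] with ω hω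
      simp only [hω]
      simp
    have hint : Integrable (fun q : S × Ω => g q.2 * Z q.1 q.2) (μ.prod P) := by
      have hmeas : Measurable fun q : S × Ω => g q.2 * Z q.1 q.2 :=
        (hgm.comp measurable_snd).mul hZ
      have hm (p : S) : AEStronglyMeasurable (Z p) P :=
        (hZ.comp (measurable_const.prodMk measurable_id)).aestronglyMeasurable
      rw [integrable_prod_iff hmeas.aestronglyMeasurable]
      refine ⟨ae_of_all _ fun p => integrable_mul_of_integrable_sq
        hgm.aestronglyMeasurable (hm p) hg2 (hZ2 p), ?_⟩
      refine Integrable.of_bound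
        hmeas.norm.stronglyMeasurable.integral_prod_right.aestronglyMeasurable
        (max M (∫ ω, g ω ^ 2 ∂P)) (ae_of_all _ fun p => ?_)
      rw [Real.norm_of_nonneg (integral_nonneg fun _ => norm_nonneg _)]
      exact integral_abs_mul_le hgm.aestronglyMeasurable (hm p) hg2 (hZ2 p) (le_max_right _ _)
        ((hM p).trans (le_max_left _ _))
    rw [L2.inner_def]
    have h2 : ∫ ω, inner ℝ (g ω) ((hI.toLp _ : Lp ℝ 2 P) ω) ∂P =
        ∫ ω, ∫ p, g ω * Z p ω ∂μ ∂P := by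
      refine integral_congr_ae ?_
      filter_upwards [hI.coeFn_toLp] with ω hω
      rw [hω, integral_const_mul]
      simp [mul_comm]
    rw [h2, ← integral_integral_swap hint]
    simp [hgp]
  have h3 := map_eq_gaussianReal_of_mem_closure_span hG h0 hmem
  rw [Measure.map_congr hI.coeFn_toLp] at h3
  rw [h3]
  congr 2
  refine integral_congr_ae ?_
  filter_upwards [hI.coeFn_toLp] with ω hω
  rw [hω]

end SecondMoment

/-! ### The Hermite remainder of the indicator and its Gaussian smoothing -/

section Remainder

/-- The part of the indicator of `[u, ∞)` that remains after subtracting its Hermite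
projections of order `0` and `1`. -/
def excursionRemainder (u z : ℝ) : ℝ :=
  (Ici u).indicator 1 z - (1 - cdf (gaussianReal 0 1) u) - gaussianPDFReal 0 1 u * z

theorem gaussianPDFReal_zero_one (x : ℝ) :
    gaussianPDFReal 0 1 x = (√(2 * Real.pi))⁻¹ * Real.exp (-x ^ 2 / 2) := by
  simp [gaussianPDFReal]

theorem inv_sqrt_two_pi_le_one : (√(2 * Real.pi))⁻¹ ≤ 1 := by
  apply inv_le_one_of_one_le₀
  rw [Real.one_le_sqrt]
  linarith [Real.pi_gt_three]

theorem gaussianPDFReal_le_one (x : ℝ) : gaussianPDFReal 0 1 x ≤ 1 := by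
  rw [gaussianPDFReal_zero_one]
  have h : Real.exp (-x ^ 2 / 2) ≤ 1 := Real.exp_le_one_iff.2 (by nlinarith [sq_nonneg x])
  have h0 := inv_sqrt_two_pi_le_one
  have h1 : 0 ≤ (√(2 * Real.pi))⁻¹ := by positivity
  nlinarith [Real.exp_pos (-x ^ 2 / 2)]

/-- The derivative is `-z φ(z)`, bounded by one since `|z| ≤ exp (z² / 2)` and `1 / √(2π) ≤ 1`. -/
theorem abs_gaussianPDFReal_sub_le (x y : ℝ) :
    |gaussianPDFReal 0 1 x - gaussianPDFReal 0 1 y| ≤ |x - y| := by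
  have hd (z : ℝ) : HasDerivAt (gaussianPDFReal 0 1)
      ((√(2 * Real.pi))⁻¹ * (Real.exp (-z ^ 2 / 2) * (-z))) z := by
    have h1 : HasDerivAt (fun z : ℝ => -z ^ 2 / 2) (-z) z := by
      have := ((hasDerivAt_pow 2 z).neg).div_const 2
      simp only [Nat.cast_ofNat, Nat.add_one_sub_one, pow_one] at this
      convert! this using 1
      ring
    have h2 := (h1.exp).const_mul (√(2 * Real.pi))⁻¹
    exact h2.congr_of_eventuallyEq (Eventually.of_forall gaussianPDFReal_zero_one)
  have hb (z : ℝ) : ‖(√(2 * Real.pi))⁻¹ * (Real.exp (-z ^ 2 / 2) * (-z))‖ ≤ 1 := by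
    have h1 : 0 ≤ (√(2 * Real.pi))⁻¹ := by positivity
    have h3 : |z| * Real.exp (-z ^ 2 / 2) ≤ 1 := by
      have h4 := Real.add_one_le_exp (z ^ 2 / 2)
      have h5 : |z| ≤ Real.exp (z ^ 2 / 2) := by
        nlinarith [sq_nonneg (|z| - 1), sq_abs z]
      calc |z| * Real.exp (-z ^ 2 / 2) ≤ Real.exp (z ^ 2 / 2) * Real.exp (-z ^ 2 / 2) := by
            gcongr
        _ = 1 := by rw [← Real.exp_add]; simp [neg_div]
    rw [norm_mul, norm_mul, Real.norm_of_nonneg h1, Real.norm_of_nonneg (Real.exp_pos _).le,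
      norm_neg, Real.norm_eq_abs]
    have h6 : 0 ≤ |z| * Real.exp (-z ^ 2 / 2) := by positivity
    nlinarith [inv_sqrt_two_pi_le_one]
  simpa using Convex.norm_image_sub_le_of_norm_hasDerivWithin_le (C := 1)
    (fun z _ => (hd z).hasDerivWithinAt) (fun z _ => hb z) convex_univ (mem_univ y) (mem_univ x)

theorem cdf_gaussianReal_sub (u v : ℝ) :
    cdf (gaussianReal 0 1) v - cdf (gaussianReal 0 1) u =
      ∫ x in u..v, gaussianPDFReal 0 1 x := by
  have h (w : ℝ) : cdf (gaussianReal 0 1) w = ∫ x in Iic w, gaussianPDFReal 0 1 x := by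
    rw [cdf_eq_real, measureReal_def, gaussianReal_apply_eq_integral _ one_ne_zero,
      ENNReal.toReal_ofReal (integral_nonneg fun x => gaussianPDFReal_nonneg _ _ _)]
  rw [h, h, intervalIntegral.integral_Iic_sub_Iic
    (integrable_gaussianPDFReal _ _).integrableOn (integrable_gaussianPDFReal _ _).integrableOn]

/-- First order Taylor estimate for the standard normal distribution function. -/
theorem abs_cdf_gaussianReal_sub_sub_le (u v : ℝ) :
    |cdf (gaussianReal 0 1) v - cdf (gaussianReal 0 1) u - gaussianPDFReal 0 1 u * (v - u)| ≤
      (v - u) ^ 2 := by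
  have h1 : cdf (gaussianReal 0 1) v - cdf (gaussianReal 0 1) u -
      gaussianPDFReal 0 1 u * (v - u) =
      ∫ x in u..v, (gaussianPDFReal 0 1 x - gaussianPDFReal 0 1 u) := by
    rw [intervalIntegral.integral_sub (integrable_gaussianPDFReal _ _).intervalIntegrable
      intervalIntegrable_const, cdf_gaussianReal_sub]
    simp [mul_comm]
  rw [h1]
  have h2 := intervalIntegral.norm_integral_le_of_norm_le_const (a := u) (b := v) (C := |v - u|)
    (f := fun x => gaussianPDFReal 0 1 x - gaussianPDFReal 0 1 u) (fun x hx => by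
      refine (abs_gaussianPDFReal_sub_le x u).trans ?_
      exact abs_sub_left_of_mem_uIcc (uIoc_subset_uIcc hx))
  rw [← sq, sq_abs] at h2
  exact h2

theorem measurable_excursionRemainder (u : ℝ) : Measurable (excursionRemainder u) := by
  unfold excursionRemainder
  have : Measurable ((Ici u).indicator (1 : ℝ → ℝ)) := measurable_one.indicator measurableSet_Ici
  fun_prop

theorem abs_excursionRemainder_le (u z : ℝ) : |excursionRemainder u z| ≤ 1 + |z| := by
  have h1 : |(Ici u).indicator 1 z - (1 - cdf (gaussianReal 0 1) u)| ≤ 1 := by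
    have h2 := cdf_nonneg (gaussianReal 0 1) u
    have h3 := cdf_le_one (gaussianReal 0 1) u
    by_cases hz : z ∈ Ici u
    · rw [indicator_of_mem hz, abs_le]
      constructor <;> simp only [Pi.one_apply] <;> linarith
    · rw [indicator_of_notMem hz, abs_le]
      constructor <;> linarith
  have h4 : |gaussianPDFReal 0 1 u * z| ≤ |z| := by
    rw [abs_mul, abs_of_nonneg (gaussianPDFReal_nonneg _ _ _)]
    nlinarith [gaussianPDFReal_le_one u, abs_nonneg z]
  exact (abs_sub _ _).trans (add_le_add h1 h4)

theorem integrable_abs_pow_gaussianReal (n : ℕ) :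
    Integrable (fun x : ℝ => |x| ^ n) (gaussianReal 0 1) := by
  have h := (memLp_id_gaussianReal (μ := 0) (v := 1) (n : NNReal)).integrable_norm_pow' 
  simpa using h

/-- The smoothed remainder: averaging over an independent Gaussian variable. -/
theorem integral_excursionRemainder_affine {s : ℝ} (hs : 0 < s) (u r x : ℝ) :
    ∫ w, excursionRemainder u (r * x + s * w) ∂(gaussianReal 0 1) =
      cdf (gaussianReal 0 1) u - cdf (gaussianReal 0 1) ((u - r * x) / s) -
        gaussianPDFReal 0 1 u * (r * x) := by
  have hset : (fun w => (Ici u).indicator (1 : ℝ → ℝ) (r * x + s * w)) =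
      (Ici ((u - r * x) / s)).indicator 1 := by
    ext w
    simp only [indicator, mem_Ici, div_le_iff₀ hs, Pi.one_apply]
    congr 1
    rw [eq_iff_iff]
    constructor <;> intro h <;> linarith
  have hIci (v : ℝ) : (gaussianReal 0 1).real (Ici v) = 1 - cdf (gaussianReal 0 1) v := by
    have : NullSingletonClass (gaussianReal 0 1) := nullSingletonClass_gaussianReal one_ne_zero
    rw [measureReal_congr (Ioi_ae_eq_Ici (μ := gaussianReal 0 1) (a := v)).symm, ← compl_Iic,
      probReal_compl_eq_one_sub measurableSet_Iic, cdf_eq_real]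
  have hid : Integrable (fun w : ℝ => w) (gaussianReal 0 1) := by
    exact (memLp_id_gaussianReal (μ := 0) (v := 1) 1).integrable le_rfl
  unfold excursionRemainder
  have hint1 : Integrable (fun w => (Ici u).indicator (1 : ℝ → ℝ) (r * x + s * w))
      (gaussianReal 0 1) := by
    rw [hset]
    exact (integrable_const (1 : ℝ)).indicator measurableSet_Ici
  have hint2 : Integrable (fun w => gaussianPDFReal 0 1 u * (r * x + s * w))
      (gaussianReal 0 1) := ((integrable_const _).add (hid.const_mul s)).const_mul _
  have hint3 : Integrable (fun w => (Ici u).indicator (1 : ℝ → ℝ) (r * x + s * w) -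
      (1 - cdf (gaussianReal 0 1) u)) (gaussianReal 0 1) := hint1.sub (integrable_const _)
  rw [integral_sub hint3 hint2, integral_sub hint1 (integrable_const _), hset,
    integral_indicator_one measurableSet_Ici, hIci, integral_const_mul,
    integral_add (integrable_const _) (hid.const_mul s), integral_const_mul s,
    integral_id_gaussianReal]
  simp

/-- A polynomial dominating the smoothed remainder. -/
def remainderBound (u x : ℝ) : ℝ := (2 * |x| + |u|) ^ 2 + 2 * (|u| + |x|)

/-- The smoothed value is `Φ(u) - Φ(v) - φ(u) r x` with `v = (u - r x) / √(1 - r²)`. Since `v - u =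
-r x + O(r²)`, the linear Taylor term of `Φ` cancels `φ(u) r x` up to second order. The restriction
`r ≤ 1 / 2` keeps the divisor away from zero. -/
theorem abs_integral_excursionRemainder_affine_le (u x : ℝ) {r : ℝ} (h0 : 0 ≤ r)
    (h1 : r ≤ 1 / 2) :
    |∫ w, excursionRemainder u (r * x + √(1 - r ^ 2) * w) ∂(gaussianReal 0 1)| ≤
      r ^ 2 * remainderBound u x := by
  set s := √(1 - r ^ 2) with hs
  have hs2 : s ^ 2 = 1 - r ^ 2 := Real.sq_sqrt (by nlinarith)
  have hs_half : 1 / 2 ≤ s := by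
    rw [hs]
    apply Real.le_sqrt_of_sq_le
    nlinarith
  have hs0 : 0 < s := by linarith
  have hs1 : s ≤ 1 := by nlinarith
  rw [integral_excursionRemainder_affine hs0]
  set v := (u - r * x) / s with hv
  have hvs : v * s = u - r * x := by rw [hv]; field_simp
  have hT := abs_cdf_gaussianReal_sub_sub_le u v
  have hc0 : 0 ≤ 1 / s - 1 := by
    rw [sub_nonneg, le_div_iff₀ hs0]
    linarith
  -- `1 - s ≤ 1 - s² = r²`, and dividing by `s ≥ 1 / 2` costs a factor two.
  have hc : 1 / s - 1 ≤ 2 * r ^ 2 := by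
    rw [sub_le_iff_le_add, div_le_iff₀ hs0]
    nlinarith [mul_nonneg (sq_nonneg r) hs0.le]
  have hvu : v - u + r * x = (u - r * x) * (1 / s - 1) := by rw [hv]; ring
  have hux : |u - r * x| ≤ |u| + |x| := by
    refine (abs_sub _ _).trans ?_
    rw [abs_mul, abs_of_nonneg h0]
    nlinarith [abs_nonneg x]
  have hA : |v - u + r * x| ≤ 2 * r ^ 2 * (|u| + |x|) := by
    rw [hvu, abs_mul, abs_of_nonneg hc0, mul_comm]
    exact mul_le_mul hc hux (abs_nonneg _) (by positivity)
  -- Here `2 r ≤ 1` trades one factor `r` of the quadratic term, leaving a bound linear in `r` to be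
  -- squared in the Taylor error.
  have hB : |v - u| ≤ r * (2 * |x| + |u|) := by
    have h2 : |v - u| ≤ |v - u + r * x| + |r * x| := by
      have := abs_sub (v - u + r * x) (r * x)
      simpa using this
    rw [abs_mul, abs_of_nonneg h0] at h2
    nlinarith [mul_nonneg h0 (add_nonneg (abs_nonneg u) (abs_nonneg x))]
  have hB2 : (v - u) ^ 2 ≤ r ^ 2 * (2 * |x| + |u|) ^ 2 := by
    rw [← sq_abs, ← mul_pow]
    exact pow_le_pow_left₀ (abs_nonneg _) hB 2
  have hφ0 := gaussianPDFReal_nonneg 0 1 u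
  have hφ1 := gaussianPDFReal_le_one u
  have hid : cdf (gaussianReal 0 1) u - cdf (gaussianReal 0 1) v -
      gaussianPDFReal 0 1 u * (r * x) =
      -((cdf (gaussianReal 0 1) v - cdf (gaussianReal 0 1) u -
        gaussianPDFReal 0 1 u * (v - u)) + gaussianPDFReal 0 1 u * (v - u + r * x)) := by ring
  rw [hid, abs_neg]
  refine (abs_add_le _ _).trans ?_
  rw [abs_mul, abs_of_nonneg hφ0]
  unfold remainderBound
  have : gaussianPDFReal 0 1 u * |v - u + r * x| ≤ |v - u + r * x| := by
    nlinarith [abs_nonneg (v - u + r * x)]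
  nlinarith

/-- The constant in the two-point estimate for the remainder. -/
def remainderConst (u : ℝ) : ℝ :=
  ∫ x, (1 + |x|) * remainderBound u x ∂(gaussianReal 0 1) +
    4 * ∫ x, (1 + |x|) ^ 2 ∂(gaussianReal 0 1)

theorem integrable_one_add_abs_sq :
    Integrable (fun x : ℝ => (1 + |x|) ^ 2) (gaussianReal 0 1) := by
  have h : (fun x : ℝ => (1 + |x|) ^ 2) = fun x => 1 + (2 * |x| ^ 1 + |x| ^ 2) := by
    ext x; ring
  rw [h]
  exact (integrable_const _).add
    (((integrable_abs_pow_gaussianReal 1).const_mul 2).add (integrable_abs_pow_gaussianReal 2))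

theorem integrable_mul_remainderBound (u : ℝ) :
    Integrable (fun x : ℝ => (1 + |x|) * remainderBound u x) (gaussianReal 0 1) := by
  have h : (fun x : ℝ => (1 + |x|) * remainderBound u x) = fun x =>
      (|u| ^ 2 + 2 * |u|) + ((|u| ^ 2 + 6 * |u| + 2) * |x| ^ 1 +
        ((4 * |u| + 6) * |x| ^ 2 + 4 * |x| ^ 3)) := by
    ext x
    unfold remainderBound
    ring
  rw [h]
  exact (integrable_const _).add (((integrable_abs_pow_gaussianReal 1).const_mul _).add
    (((integrable_abs_pow_gaussianReal 2).const_mul _).add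
      ((integrable_abs_pow_gaussianReal 3).const_mul _)))

theorem remainderBound_nonneg (u x : ℝ) : 0 ≤ remainderBound u x := by
  unfold remainderBound
  positivity

end Remainder

/-! ### Covariance of the remainder at two points -/

section TwoPoint

variable {Ω : Type*} [MeasurableSpace Ω] {P : Measure Ω}

theorem map_eq_gaussianReal_zero_one {X : Ω → ℝ} (hX : HasGaussianLaw X P)
    (h0 : ∫ ω, X ω ∂P = 0) (h1 : ∫ ω, X ω ^ 2 ∂P = 1) : P.map X = gaussianReal 0 1 := by
  rw [hX.map_eq_gaussianReal, h0, variance_of_integral_eq_zero hX.aemeasurable h0, h1]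
  simp

theorem integrable_sq_excursionRemainder {X : Ω → ℝ} (hX : P.map X = gaussianReal 0 1)
    (hXm : AEMeasurable X P) (u : ℝ) :
    Integrable (fun ω => excursionRemainder u (X ω) ^ 2) P ∧
      ∫ ω, excursionRemainder u (X ω) ^ 2 ∂P ≤ ∫ x, (1 + |x|) ^ 2 ∂(gaussianReal 0 1) := by
  have hle (x : ℝ) : excursionRemainder u x ^ 2 ≤ (1 + |x|) ^ 2 := by
    rw [← sq_abs]
    exact pow_le_pow_left₀ (abs_nonneg _) (abs_excursionRemainder_le u x) 2
  have hm : Measurable fun x => excursionRemainder u x ^ 2 :=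
    (measurable_excursionRemainder u).pow_const 2
  have h1 : Integrable (fun x => excursionRemainder u x ^ 2) (gaussianReal 0 1) := by
    refine integrable_one_add_abs_sq.mono' hm.aestronglyMeasurable (ae_of_all _ fun x => ?_)
    rw [Real.norm_of_nonneg (sq_nonneg _)]
    exact hle x
  rw [← hX] at h1
  refine ⟨h1.comp_aemeasurable hXm, ?_⟩
  have h2 := integral_map (μ := P) hXm (f := fun x => excursionRemainder u x ^ 2)
    hm.aestronglyMeasurable
  rw [← h2, hX]
  rw [hX] at h1
  exact integral_mono h1 integrable_one_add_abs_sq hle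

/-- The covariance of the remainders at two points is of second order in the correlation. -/
theorem abs_integral_excursionRemainder_mul_le [IsProbabilityMeasure P] {X Y : Ω → ℝ}
    (hXY : HasGaussianLaw (fun ω => (X ω, Y ω)) P)
    (hX0 : ∫ ω, X ω ∂P = 0) (hX1 : ∫ ω, X ω ^ 2 ∂P = 1)
    (hY0 : ∫ ω, Y ω ∂P = 0) (hY1 : ∫ ω, Y ω ^ 2 ∂P = 1)
    (hr : 0 ≤ ∫ ω, X ω * Y ω ∂P) (u : ℝ) :
    |∫ ω, excursionRemainder u (X ω) * excursionRemainder u (Y ω) ∂P| ≤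
      remainderConst u * (∫ ω, X ω * Y ω ∂P) ^ 2 := by
  set r := ∫ ω, X ω * Y ω ∂P with hrdef
  have hXm := hXY.fst.aemeasurable
  have hYm := hXY.snd.aemeasurable
  have hXlaw := map_eq_gaussianReal_zero_one hXY.fst hX0 hX1
  have hYlaw := map_eq_gaussianReal_zero_one hXY.snd hY0 hY1
  have hA : 0 ≤ ∫ x, (1 + |x|) * remainderBound u x ∂(gaussianReal 0 1) :=
    integral_nonneg fun x => mul_nonneg (by positivity) (remainderBound_nonneg u x)
  have hB : 0 ≤ ∫ x, (1 + |x|) ^ 2 ∂(gaussianReal 0 1) :=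
    integral_nonneg fun x => by positivity
  -- Only small correlations need the smoothing argument; for large ones `r²` is bounded below and
  -- second moments suffice.
  rcases le_or_gt r (1 / 2) with hr2 | hr2
  · set s := √(1 - r ^ 2) with hs
    have hs2 : s ^ 2 = 1 - r ^ 2 := Real.sq_sqrt (by nlinarith)
    have hs0 : 0 < s := Real.sqrt_pos.2 (by nlinarith)
    -- The normalized residual of the regression of `Y` on `X`: standard normal and uncorrelated
    -- with `X`, hence independent of it by joint Gaussianity.
    set W : Ω → ℝ := fun ω => s⁻¹ * (Y ω - r * X ω) with hW
    have hXW : HasGaussianLaw (fun ω => (X ω, W ω)) P :=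
      hXY.map_fun ((ContinuousLinearMap.fst ℝ ℝ ℝ).prod
        (s⁻¹ • (ContinuousLinearMap.snd ℝ ℝ ℝ - r • ContinuousLinearMap.fst ℝ ℝ ℝ)))
    have hXi := hXY.fst.integrable
    have hYi := hXY.snd.integrable
    have hX2 := hXY.fst.memLp_two.integrable_sq
    have hY2 := hXY.snd.memLp_two.integrable_sq
    have hXYi : Integrable (fun ω => X ω * Y ω) P :=
      hXY.fst.memLp_two.integrable_mul hXY.snd.memLp_two
    have hW0 : ∫ ω, W ω ∂P = 0 := by
      simp only [hW]
      rw [integral_const_mul, integral_sub hYi (hXi.const_mul r), integral_const_mul, hX0, hY0]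
      simp
    have hW1 : ∫ ω, W ω ^ 2 ∂P = 1 := by
      have : (fun ω => W ω ^ 2) = fun ω =>
          (s⁻¹) ^ 2 * (Y ω ^ 2 - 2 * r * (X ω * Y ω) + r ^ 2 * X ω ^ 2) := by
        ext ω
        simp only [hW]
        ring
      have hYX : Integrable (fun ω => Y ω ^ 2 - 2 * r * (X ω * Y ω)) P :=
        hY2.sub (hXYi.const_mul _)
      rw [this, integral_const_mul, integral_add hYX (hX2.const_mul _),
        integral_sub hY2 (hXYi.const_mul _), integral_const_mul, integral_const_mul, hX1, hY1,
        ← hrdef]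
      have h3 : 1 - 2 * r * r + r ^ 2 * 1 = s ^ 2 := by rw [hs2]; ring
      rw [h3]
      field_simp
    have hXW0 : ∫ ω, X ω * W ω ∂P = 0 := by
      have : (fun ω => X ω * W ω) = fun ω => s⁻¹ * (X ω * Y ω - r * X ω ^ 2) := by
        ext ω
        simp only [hW]
        ring
      rw [this, integral_const_mul, integral_sub hXYi (hX2.const_mul _), integral_const_mul, hX1,
        ← hrdef]
      simp
    have hind : IndepFun X W P := by
      apply hXW.indepFun_of_covariance_eq_zero
      rw [covariance_eq_sub hXW.fst.memLp_two hXW.snd.memLp_two, hX0]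
      simpa using hXW0
    have hWlaw := map_eq_gaussianReal_zero_one hXW.snd hW0 hW1
    have hjoint : P.map (fun ω => (X ω, W ω)) = (gaussianReal 0 1).prod (gaussianReal 0 1) := by
      rw [hind.map_prod_eq_prod_map_map hXm hXW.snd.aemeasurable, hXlaw, hWlaw]
    have hYeq (ω : Ω) : Y ω = r * X ω + s * W ω := by
      simp only [hW]
      field_simp
      ring
    set f : ℝ × ℝ → ℝ := fun q =>
      excursionRemainder u q.1 * excursionRemainder u (r * q.1 + s * q.2) with hf
    have hfm : Measurable f := by
      have h1 := measurable_excursionRemainder u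
      exact (h1.comp measurable_fst).mul (h1.comp (by fun_prop))
    have hint : Integrable f ((gaussianReal 0 1).prod (gaussianReal 0 1)) := by
      rw [← hjoint, integrable_map_measure hfm.aestronglyMeasurable hXW.aemeasurable]
      have h1 : f ∘ (fun ω => (X ω, W ω)) =
          fun ω => excursionRemainder u (X ω) * excursionRemainder u (Y ω) := by
        ext ω
        simp [hf, hYeq]
      rw [h1]
      exact integrable_mul_of_integrable_sq
        ((measurable_excursionRemainder u).comp_aemeasurable hXm).aestronglyMeasurable
        ((measurable_excursionRemainder u).comp_aemeasurable hYm).aestronglyMeasurable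
        (integrable_sq_excursionRemainder hXlaw hXm u).1
        (integrable_sq_excursionRemainder hYlaw hYm u).1
    have heq : ∫ ω, excursionRemainder u (X ω) * excursionRemainder u (Y ω) ∂P =
        ∫ x, excursionRemainder u x *
          ∫ w, excursionRemainder u (r * x + s * w) ∂(gaussianReal 0 1) ∂(gaussianReal 0 1) := by
      have h1 : ∫ ω, excursionRemainder u (X ω) * excursionRemainder u (Y ω) ∂P =
          ∫ ω, f (X ω, W ω) ∂P := by
        simp only [hf, ← hYeq]
      rw [h1, ← integral_map hXW.aemeasurable hfm.aestronglyMeasurable, hjoint,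
        integral_prod f hint]
      simp only [hf, integral_const_mul]
    rw [heq, ← Real.norm_eq_abs]
    refine (norm_integral_le_of_norm_le ((integrable_mul_remainderBound u).const_mul (r ^ 2))
      (ae_of_all _ fun x => ?_)).trans ?_
    · rw [norm_mul, Real.norm_eq_abs, Real.norm_eq_abs]
      calc _ ≤ (1 + |x|) * (r ^ 2 * remainderBound u x) :=
            mul_le_mul (abs_excursionRemainder_le u x)
              (abs_integral_excursionRemainder_affine_le u x hr hr2) (abs_nonneg _) (by positivity)
        _ = _ := by ring
    · rw [integral_const_mul]
      unfold remainderConst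
      nlinarith [mul_nonneg (sq_nonneg r) hB]
  · have h1 : ∫ ω, |excursionRemainder u (X ω) * excursionRemainder u (Y ω)| ∂P ≤
        ∫ x, (1 + |x|) ^ 2 ∂(gaussianReal 0 1) :=
      integral_abs_mul_le
        ((measurable_excursionRemainder u).comp_aemeasurable hXm).aestronglyMeasurable
        ((measurable_excursionRemainder u).comp_aemeasurable hYm).aestronglyMeasurable
        (integrable_sq_excursionRemainder hXlaw hXm u).1
        (integrable_sq_excursionRemainder hYlaw hYm u).1
        (integrable_sq_excursionRemainder hXlaw hXm u).2
        (integrable_sq_excursionRemainder hYlaw hYm u).2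
    refine (abs_integral_le_integral_abs).trans (h1.trans ?_)
    unfold remainderConst
    -- This is the origin of the factor 4 in `remainderConst`.
    have h2 : 1 ≤ 4 * r ^ 2 := by nlinarith
    nlinarith [mul_nonneg hA (sq_nonneg r)]

end TwoPoint

/-! ### Fubini rearrangements and the time-lag formula -/

section ProductIntegrals

/-- Rearrangement of a fourfold integral of a bounded measurable function. -/
theorem integral_prod_prod_comm {α β : Type*} [MeasurableSpace α] [MeasurableSpace β]
    {μ : Measure α} {ν : Measure β} [IsFiniteMeasure μ] [IsFiniteMeasure ν]
    {F : (α × β) × (α × β) → ℝ} (hF : Measurable F) {M : ℝ} (hM : ∀ q, |F q| ≤ M) :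
    ∫ q, F q ∂((μ.prod ν).prod (μ.prod ν)) =
      ∫ x : α × α, ∫ t : β × β, F ((x.1, t.1), (x.2, t.2)) ∂(ν.prod ν) ∂(μ.prod μ) := by
  have hFint : Integrable F ((μ.prod ν).prod (μ.prod ν)) :=
    .of_bound hF.aestronglyMeasurable M (ae_of_all _ hM)
  have hGm : Measurable fun q : (α × α) × (β × β) => F ((q.1.1, q.2.1), (q.1.2, q.2.2)) :=
    hF.comp (by fun_prop)
  have hGint : Integrable (fun q : (α × α) × (β × β) => F ((q.1.1, q.2.1), (q.1.2, q.2.2)))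
      ((μ.prod μ).prod (ν.prod ν)) :=
    .of_bound hGm.aestronglyMeasurable M (ae_of_all _ fun q => hM _)
  rw [integral_prod F hFint, integral_prod _ hFint.integral_prod_left,
    integral_prod _ hGint.integral_prod_left]
  refine integral_congr_ae (ae_of_all _ fun x => ?_)
  have h1 (t : β) : ∫ q, F ((x, t), q) ∂(μ.prod ν) = ∫ y, ∫ s, F ((x, t), (y, s)) ∂ν ∂μ :=
    integral_prod _ (.of_bound (hF.comp (by fun_prop)).aestronglyMeasurable M
      (ae_of_all _ fun q => hM _))
  have h2 (y : α) : ∫ r : β × β, F ((x, r.1), (y, r.2)) ∂(ν.prod ν) =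
      ∫ t, ∫ s, F ((x, t), (y, s)) ∂ν ∂ν :=
    integral_prod (fun r : β × β => F ((x, r.1), (y, r.2)))
      (.of_bound (hF.comp (by fun_prop)).aestronglyMeasurable M (ae_of_all _ fun q => hM _))
  simp only [h1, h2]
  have h3 : Measurable fun q : (β × α) × β => F ((x, q.1.1), (q.1.2, q.2)) :=
    hF.comp (by fun_prop)
  have h4 : Integrable (fun q : (β × α) × β => F ((x, q.1.1), (q.1.2, q.2)))
      ((ν.prod μ).prod ν) := .of_bound h3.aestronglyMeasurable M (ae_of_all _ fun q => hM _)
  exact integral_integral_swap h4.integral_prod_left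

theorem intervalIntegrable_of_bounded {h : ℝ → ℝ} (hm : Measurable h) {M : ℝ}
    (hM : ∀ x, |h x| ≤ M) (a b : ℝ) : IntervalIntegrable h volume a b := by
  rw [intervalIntegrable_iff]
  exact Measure.integrableOn_of_bounded (M := M) (by simp) hm.aestronglyMeasurable
    (ae_of_all _ hM)

/-- Fubini on the triangle `τ ≤ t ≤ T`: each `τ` is met by a set of `t` of length `T - τ`. -/
theorem integral_integral_Ioc_eq {h : ℝ → ℝ} (hm : Measurable h) {M : ℝ} (hM : ∀ x, |h x| ≤ M)
    {T : ℝ} (hT : 0 ≤ T) :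
    ∫ t in (0 : ℝ)..T, ∫ τ in (0 : ℝ)..t, h τ = ∫ τ in (0 : ℝ)..T, (T - τ) * h τ := by
  have hmeas : Measurable (Function.uncurry fun t τ : ℝ => (Iic t).indicator h τ) := by
    have : (Function.uncurry fun t τ : ℝ => (Iic t).indicator h τ) =
        {q : ℝ × ℝ | q.2 ≤ q.1}.indicator fun q => h q.2 := by
      ext q
      simp [Function.uncurry, indicator]
    rw [this]
    exact (hm.comp measurable_snd).indicator (measurableSet_le measurable_snd measurable_fst)
  have hint : Integrable (Function.uncurry fun t τ : ℝ => (Iic t).indicator h τ)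
      ((volume.restrict (Ioc 0 T)).prod (volume.restrict (Ioc 0 T))) := by
    refine .of_bound hmeas.aestronglyMeasurable M (ae_of_all _ fun q => ?_)
    exact (norm_indicator_le_norm_self _ _).trans (hM q.2)
  have h1 : ∫ t in (0 : ℝ)..T, ∫ τ in (0 : ℝ)..t, h τ =
      ∫ t in Ioc 0 T, ∫ τ in Ioc 0 T, (Iic t).indicator h τ := by
    rw [intervalIntegral.integral_of_le hT]
    refine setIntegral_congr_fun measurableSet_Ioc fun t ht => ?_
    rw [intervalIntegral.integral_of_le ht.1.le, setIntegral_indicator measurableSet_Iic]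
    congr 2
    ext τ
    simp only [mem_Ioc, mem_inter_iff, mem_Iic]
    constructor
    · rintro ⟨h1, h2⟩
      exact ⟨⟨h1, h2.trans ht.2⟩, h2⟩
    · rintro ⟨⟨h1, _⟩, h2⟩
      exact ⟨h1, h2⟩
  rw [h1, integral_integral_swap hint, intervalIntegral.integral_of_le hT]
  refine setIntegral_congr_fun measurableSet_Ioc fun τ hτ => ?_
  have h2 : (fun t : ℝ => (Iic t).indicator h τ) = (Ici τ).indicator fun _ => h τ := by
    ext t
    simp [indicator]
  simp only [h2]
  rw [setIntegral_indicator measurableSet_Ici]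
  have h3 : Ioc 0 T ∩ Ici τ = Icc τ T := by
    ext t
    simp only [mem_inter_iff, mem_Ioc, mem_Ici, mem_Icc]
    constructor
    · rintro ⟨⟨_, h2⟩, h3⟩
      exact ⟨h3, h2⟩
    · rintro ⟨h2, h3⟩
      exact ⟨⟨hτ.1.trans_le h2, h3⟩, h2⟩
  rw [h3, setIntegral_const, Real.volume_real_Icc_of_le hτ.2, smul_eq_mul]

/-- The double integral over `[0, T]²` of a function of the time lag. -/
theorem integral_time_lag {h : ℝ → ℝ} (hm : Measurable h) {M : ℝ} (hM : ∀ x, |h x| ≤ M)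
    {T : ℝ} (hT : 0 ≤ T) :
    ∫ r : ℝ × ℝ, h |r.1 - r.2| ∂((volume.restrict (Icc 0 T)).prod (volume.restrict (Icc 0 T))) =
      2 * ∫ τ in (0 : ℝ)..T, (T - τ) * h τ := by
  have hint : Integrable (fun r : ℝ × ℝ => h |r.1 - r.2|)
      ((volume.restrict (Icc 0 T)).prod (volume.restrict (Icc 0 T))) :=
    .of_bound (hm.comp (by fun_prop)).aestronglyMeasurable M (ae_of_all _ fun r => hM _)
  have hii (a b : ℝ) : IntervalIntegrable h volume a b := intervalIntegrable_of_bounded hm hM a b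
  have hcont : Continuous fun t => ∫ τ in (0 : ℝ)..t, h τ :=
    intervalIntegral.continuous_primitive hii 0
  -- Cutting at `s = t` gives the primitive of `h` at `t` and at `T - t`. Both have the same
  -- integral over `[0, T]`, whence the factor 2.
  have hinner (t : ℝ) (ht : t ∈ Ioc 0 T) : ∫ s in Icc 0 T, h |t - s| =
      (∫ τ in (0 : ℝ)..t, h τ) + ∫ τ in (0 : ℝ)..(T - t), h τ := by
    rw [integral_Icc_eq_integral_Ioc, ← intervalIntegral.integral_of_le hT]
    have habs (a b : ℝ) : IntervalIntegrable (fun s => h |t - s|) volume a b :=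
      intervalIntegrable_of_bounded (hm.comp (by fun_prop)) (fun s => hM _) a b
    rw [← intervalIntegral.integral_add_adjacent_intervals (habs 0 t) (habs t T)]
    congr 1
    · have h1 : ∫ s in (0 : ℝ)..t, h |t - s| = ∫ s in (0 : ℝ)..t, h (t - s) := by
        refine intervalIntegral.integral_congr fun s hs => ?_
        rw [uIcc_of_le ht.1.le] at hs
        simp only [abs_of_nonneg (sub_nonneg.2 hs.2)]
      rw [h1, intervalIntegral.integral_comp_sub_left (f := h)]
      simp
    · have h1 : ∫ s in t..T, h |t - s| = ∫ s in t..T, h (s - t) := by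
        refine intervalIntegral.integral_congr fun s hs => ?_
        rw [uIcc_of_le ht.2] at hs
        simp only [abs_sub_comm t s, abs_of_nonneg (sub_nonneg.2 hs.1)]
      rw [h1, intervalIntegral.integral_comp_sub_right (f := h)]
      simp
  have hcont' : Continuous fun t => ∫ τ in (0 : ℝ)..(T - t), h τ :=
    hcont.comp (continuous_const.sub continuous_id)
  rw [integral_prod _ hint, integral_Icc_eq_integral_Ioc,
    setIntegral_congr_fun measurableSet_Ioc hinner, ← intervalIntegral.integral_of_le hT,
    intervalIntegral.integral_add (hcont.intervalIntegrable _ _) (hcont'.intervalIntegrable _ _)]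
  have h2 := intervalIntegral.integral_comp_sub_left (a := 0) (b := T)
    (f := fun t => ∫ τ in (0 : ℝ)..t, h τ) T
  simp only [sub_self, sub_zero] at h2
  rw [h2, integral_integral_Ioc_eq hm hM hT]
  ring

end ProductIntegrals

/-! ### The law of the distance between two uniform points -/

section DistanceLaw

variable {d : ℕ}

/-- In polar coordinates the volume becomes a radial integral over a null set. Positive dimension
matters: in dimension zero the norm is constant. -/
theorem volume_norm_preimage_eq_zero (hd : 1 ≤ d) {s : Set ℝ} (h0 : volume s = 0) :
    volume ((fun x : Space d => ‖x‖) ⁻¹' s) = 0 := by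
  have : Nonempty (Fin d) := ⟨⟨0, hd⟩⟩
  have : Nontrivial (Space d) := inferInstance
  have hae : ∀ᵐ y : ℝ, s.indicator (1 : ℝ → ℝ) y = 0 := by
    have : ∀ᵐ y : ℝ, y ∉ s := measure_eq_zero_iff_ae_notMem.1 h0
    filter_upwards [this] with y hy using indicator_of_notMem hy _
  have hae' : (fun y : ℝ => y ^ (Module.finrank ℝ (Space d) - 1) • s.indicator (1 : ℝ → ℝ) y)
      =ᵐ[volume.restrict (Ioi 0)] fun _ => 0 := by
    filter_upwards [ae_restrict_of_ae hae] with y hy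
    rw [hy, smul_zero]
  have hint : Integrable (fun x : Space d => s.indicator (1 : ℝ → ℝ) ‖x‖) :=
    (integrable_fun_norm_addHaar volume).2 ((integrable_zero _ _ _).congr hae'.symm)
  have hzero := integral_fun_norm_addHaar (volume : Measure (Space d)) (s.indicator (1 : ℝ → ℝ))
  rw [integral_congr_ae hae', integral_zero, smul_zero, smul_zero] at hzero
  rw [integral_eq_zero_iff_of_nonneg
    (fun x => indicator_nonneg (f := (1 : ℝ → ℝ)) (fun _ _ => zero_le_one) _) hint] at hzero
  rw [measure_eq_zero_iff_ae_notMem]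
  filter_upwards [hzero] with x hx hxs
  rw [indicator_of_mem (mem_preimage.1 hxs)] at hx
  simp at hx

theorem IsConvexBody.volume_ne_zero {K : Set (Space d)} (hK : IsConvexBody K) : volume K ≠ 0 :=
  (Measure.measure_pos_of_nonempty_interior _ hK.nonempty_interior).ne'

theorem IsConvexBody.volume_ne_top {K : Set (Space d)} (hK : IsConvexBody K) : volume K ≠ ⊤ :=
  hK.isCompact.measure_ne_top

theorem IsConvexBody.volume_real_pos {K : Set (Space d)} (hK : IsConvexBody K) :
    0 < volume.real K :=
  ENNReal.toReal_pos hK.volume_ne_zero hK.volume_ne_top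

theorem IsConvexBody.isProbabilityMeasure_cond {K : Set (Space d)} (hK : IsConvexBody K) :
    IsProbabilityMeasure (cond volume K) :=
  cond_isProbabilityMeasure_of_finite hK.volume_ne_zero hK.volume_ne_top

/-- The law of the distance between two independent uniform points of `K`. -/
def distanceLaw (K : Set (Space d)) : Measure ℝ :=
  (twoPointLaw K).map fun p => ‖p.1 - p.2‖

theorem measurable_norm_sub : Measurable fun p : Space d × Space d => ‖p.1 - p.2‖ := by
  fun_prop

theorem distanceLaw_absolutelyContinuous (hd : 1 ≤ d) (K : Set (Space d)) :
    distanceLaw K ≪ volume := by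
  refine Measure.AbsolutelyContinuous.mk fun s hs h0 => ?_
  rw [distanceLaw, Measure.map_apply measurable_norm_sub hs]
  have hac : twoPointLaw K ≪ (volume : Measure (Space d)).prod volume :=
    cond_absolutelyContinuous.prod cond_absolutelyContinuous
  refine hac ?_
  exact (quasiMeasurePreserving_sub (volume : Measure (Space d)) volume).preimage_null
    (volume_norm_preimage_eq_zero hd h0)

theorem IsConvexBody.isProbabilityMeasure_distanceLaw {K : Set (Space d)} (hK : IsConvexBody K) :
    IsProbabilityMeasure (distanceLaw K) := by
  have := hK.isProbabilityMeasure_cond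
  have : IsProbabilityMeasure (twoPointLaw K) := by
    unfold twoPointLaw
    infer_instance
  exact Measure.isProbabilityMeasure_map measurable_norm_sub.aemeasurable

/-- A monotone function is differentiable almost everywhere, with derivative the density of the
absolutely continuous part of its Stieltjes measure. This identifies the pointwise `deriv` well
enough for use under integrals. -/
theorem distanceDensity_ae_eq {K : Set (Space d)} (hK : IsConvexBody K) :
    ∀ᵐ z : ℝ, distanceDensity K z = ((distanceLaw K).rnDeriv volume z).toReal := by
  have := hK.isProbabilityMeasure_distanceLaw
  have hcdf : distanceCDF K = cdf (distanceLaw K) := by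
    ext r
    rw [cdf_eq_real, distanceLaw, map_measureReal_apply measurable_norm_sub measurableSet_Iic]
    rfl
  have h := (cdf (distanceLaw K)).ae_hasDerivAt
  rw [measure_cdf] at h
  filter_upwards [h] with z hz
  rw [distanceDensity, hcdf, hz.deriv]

theorem distanceLaw_ae_mem (hd : 1 ≤ d) {K : Set (Space d)} (hK : IsConvexBody K) :
    ∀ᵐ z ∂(distanceLaw K), z ∈ Ioc 0 (Metric.diam K) := by
  have := hK.isProbabilityMeasure_cond
  have hK' := hK.isCompact.isClosed.measurableSet
  have h1 : ∀ᵐ z ∂(distanceLaw K), z ∈ Icc 0 (Metric.diam K) := by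
    refine (ae_map_iff measurable_norm_sub.aemeasurable measurableSet_Icc).2 ?_
    have h2 : ∀ᵐ p ∂(twoPointLaw K), p.1 ∈ K ∧ p.2 ∈ K := by
      have h3 : ∀ᵐ x ∂(ProbabilityTheory.cond volume K), x ∈ K := ae_cond_mem hK'
      exact (Measure.quasiMeasurePreserving_fst.ae h3).and (Measure.quasiMeasurePreserving_snd.ae h3)
    filter_upwards [h2] with p hp
    refine ⟨norm_nonneg _, ?_⟩
    rw [← dist_eq_norm]
    exact Metric.dist_le_diam_of_mem hK.isCompact.isBounded hp.1 hp.2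
  -- Excluding zero matches the half-open interval of the interval integral.
  have h4 : ∀ᵐ z ∂(distanceLaw K), z ≠ 0 := by
    refine (distanceLaw_absolutelyContinuous hd K).ae_le ?_
    exact Measure.ae_ne volume 0
  filter_upwards [h1, h4] with z hz hz0
  exact ⟨lt_of_le_of_ne hz.1 hz0.symm, hz.2⟩

theorem integral_distanceLaw (hd : 1 ≤ d) {K : Set (Space d)} (hK : IsConvexBody K)
    (g : ℝ → ℝ) :
    ∫ z, g z ∂(distanceLaw K) = ∫ z in (0 : ℝ)..Metric.diam K, g z * distanceDensity K z := by
  have := hK.isProbabilityMeasure_distanceLaw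
  rw [← Measure.restrict_eq_self_of_ae_mem (distanceLaw_ae_mem hd hK),
    ← setIntegral_rnDeriv_smul (distanceLaw_absolutelyContinuous hd K) measurableSet_Ioc,
    intervalIntegral.integral_of_le Metric.diam_nonneg]
  refine integral_congr_ae ?_
  filter_upwards [ae_restrict_of_ae (distanceDensity_ae_eq hK)] with z hz
  rw [hz, smul_eq_mul, mul_comm]

theorem integral_restrict_prod_norm_sub (hd : 1 ≤ d) {K : Set (Space d)} (hK : IsConvexBody K)
    {g : ℝ → ℝ} (hg : Measurable g) :
    ∫ p : Space d × Space d, g ‖p.1 - p.2‖ ∂((volume.restrict K).prod (volume.restrict K)) =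
      volume.real K ^ 2 * ∫ z in (0 : ℝ)..Metric.diam K, g z * distanceDensity K z := by
  rw [← integral_distanceLaw hd hK, distanceLaw,
    integral_map measurable_norm_sub.aemeasurable hg.aestronglyMeasurable, twoPointLaw,
    ProbabilityTheory.cond,
    Measure.prod_smul_left, Measure.prod_smul_right, smul_smul, integral_smul_measure]
  have hV := hK.volume_real_pos
  rw [measureReal_def] at *
  rw [ENNReal.toReal_mul, ENNReal.toReal_inv, smul_eq_mul]
  field_simp

end DistanceLaw

/-! ### Double integrals over the space-time window -/

section SpaceTime

variable {d : ℕ}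

/-- Lebesgue measure on the space-time window `K × [0, T]`. -/
def windowMeasure (K : Set (Space d)) (T : ℝ) : Measure (Space d × ℝ) :=
  (volume.restrict K).prod (volume.restrict (Icc 0 T))

/-- Reduction of a double integral over the window to the distance density and time lag. -/
theorem integral_windowMeasure_prod (hd : 1 ≤ d) {K : Set (Space d)} (hK : IsConvexBody K)
    {f : ℝ → ℝ → ℝ} (hf : Measurable (Function.uncurry f)) {M : ℝ} (hM : ∀ z τ, |f z τ| ≤ M)
    {T : ℝ} (hT : 0 < T) :
    ∫ p : (Space d × ℝ) × (Space d × ℝ), f ‖p.1.1 - p.2.1‖ |p.1.2 - p.2.2|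
        ∂((windowMeasure K T).prod (windowMeasure K T)) =
      2 * T * volume.real K ^ 2 * ∫ τ in (0 : ℝ)..T, (1 - τ / T) *
        ∫ z in (0 : ℝ)..Metric.diam K, f z τ * distanceDensity K z := by
  have : IsFiniteMeasure (volume.restrict K) := ⟨by
    rw [Measure.restrict_apply_univ]; exact hK.volume_ne_top.lt_top⟩
  have hfm {α : Type} [MeasurableSpace α] {a b : α → ℝ} (ha : Measurable a) (hb : Measurable b) :
      Measurable fun q => f (a q) (b q) := hf.comp (ha.prodMk hb)
  unfold windowMeasure
  rw [integral_prod_prod_comm (F := fun p : (Space d × ℝ) × (Space d × ℝ) =>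
    f ‖p.1.1 - p.2.1‖ |p.1.2 - p.2.2|) (hfm (by fun_prop) (by fun_prop)) fun q => hM _ _]
  simp only
  have h1 (x : Space d × Space d) := integral_time_lag (h := f ‖x.1 - x.2‖)
    (hfm measurable_const measurable_id) (hM _) hT.le
  simp only [h1]
  rw [integral_const_mul]
  have h2 (x : Space d × Space d) : ∫ τ in (0 : ℝ)..T, (T - τ) * f ‖x.1 - x.2‖ τ =
      ∫ τ in Ioc 0 T, (T - τ) * f ‖x.1 - x.2‖ τ := intervalIntegral.integral_of_le hT.le
  simp only [h2]
  have hint : Integrable (Function.uncurry fun (x : Space d × Space d) (τ : ℝ) =>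
      (T - τ) * f ‖x.1 - x.2‖ τ)
      (((volume.restrict K).prod (volume.restrict K)).prod (volume.restrict (Ioc 0 T))) := by
    refine .of_bound (C := T * M) (Measurable.aestronglyMeasurable ?_) ?_
    · exact (measurable_const.sub measurable_snd).mul (hfm (by fun_prop) (by fun_prop))
    · have h3 : ∀ᵐ τ ∂(volume.restrict (Ioc 0 T)), τ ∈ Ioc 0 T :=
        ae_restrict_mem measurableSet_Ioc
      filter_upwards [Measure.quasiMeasurePreserving_snd.ae h3] with q hq
      rw [Function.uncurry, norm_mul]
      refine mul_le_mul ?_ (hM _ _) (norm_nonneg _) hT.le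
      rw [Real.norm_of_nonneg (by linarith [hq.2])]
      linarith [hq.1]
  rw [integral_integral_swap hint, ← intervalIntegral.integral_of_le hT.le]
  have h4 (τ : ℝ) : ∫ x : Space d × Space d, (T - τ) * f ‖x.1 - x.2‖ τ
      ∂((volume.restrict K).prod (volume.restrict K)) = T * volume.real K ^ 2 * ((1 - τ / T) *
        ∫ z in (0 : ℝ)..Metric.diam K, f z τ * distanceDensity K z) := by
    rw [integral_const_mul, integral_restrict_prod_norm_sub hd hK (g := fun z => f z τ)
      (hfm measurable_id measurable_const)]
    field_simp
  simp only [h4]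
  rw [intervalIntegral.integral_const_mul]
  ring

end SpaceTime

/-! ### Variance asymptotics and the limit theorem -/

section LimitTheorem

variable {d : ℕ} {Ω : Type*} [MeasurableSpace Ω] {P : Measure Ω}
  {Z : Space d × ℝ → Ω → ℝ} {C : ℝ → ℝ → ℝ} {K : Set (Space d)}

theorem IsConvexBody.isFiniteMeasure_windowMeasure (hK : IsConvexBody K) (T : ℝ) :
    IsFiniteMeasure (windowMeasure K T) := by
  have : IsFiniteMeasure (volume.restrict K) := ⟨by
    rw [Measure.restrict_apply_univ]; exact hK.volume_ne_top.lt_top⟩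
  unfold windowMeasure
  infer_instance

theorem windowMeasure_eq_restrict (K : Set (Space d)) (T : ℝ) :
    windowMeasure K T = volume.restrict (K ×ˢ Icc 0 T) := by
  rw [windowMeasure, Measure.prod_restrict, Measure.volume_eq_prod]

theorem windowMeasure_real_univ (K : Set (Space d)) {T : ℝ} (hT : 0 ≤ T) :
    (windowMeasure K T).real univ = T * volume.real K := by
  rw [windowMeasure, ← univ_prod_univ, measureReal_prod_prod, measureReal_restrict_apply_univ,
    measureReal_restrict_apply_univ, Real.volume_real_Icc_of_le hT]
  ring

theorem ae_windowMeasure_prod_mem (hK : IsConvexBody K) (T : ℝ) :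
    ∀ᵐ p ∂((windowMeasure K T).prod (windowMeasure K T)), p.1.1 ∈ K ∧ p.2.1 ∈ K := by
  have h1 : ∀ᵐ p ∂(windowMeasure K T), p.1 ∈ K :=
    Measure.quasiMeasurePreserving_fst.ae (ae_restrict_mem hK.isCompact.isClosed.measurableSet)
  have := hK.isFiniteMeasure_windowMeasure T
  exact (Measure.quasiMeasurePreserving_fst.ae h1).and (Measure.quasiMeasurePreserving_snd.ae h1)

/-! ### The covariance function -/

theorem Condition1.integrable_sq (h1 : Condition1 P Z C) (p : Space d × ℝ) :
    Integrable (fun ω => Z p ω ^ 2) P :=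
  (memLp_two_of_isGaussianProcess h1.gaussian p).integrable_sq

theorem Condition1.measurable_eval (h1 : Condition1 P Z C) (p : Space d × ℝ) :
    Measurable (Z p) :=
  h1.measurable.comp (measurable_const.prodMk measurable_id)

/-- The field determines `C` only at non-negative arguments. The redundant absolute values replace
`C` by `C |z| |τ|`, which is measurable with values in `[0, 1]` on the whole plane. -/
theorem Condition1.integral_mul_eq (h1 : Condition1 P Z C) (p q : Space d × ℝ) :
    ∫ ω, Z p ω * Z q ω ∂P = C |‖p.1 - q.1‖| |(|p.2 - q.2|)| := by
  rw [abs_norm, abs_abs, ← h1.covariance]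

theorem Condition1.covariance_abs_eq (hd : 1 ≤ d) (h1 : Condition1 P Z C) (z τ : ℝ) :
    C |z| |τ| = ∫ ω, Z (EuclideanSpace.single ⟨0, hd⟩ z, τ) ω * Z (0, 0) ω ∂P := by
  rw [h1.covariance]
  simp

/-- Every pair of arguments is realized by the origin and a point of the first coordinate axis, so
measurability follows from that of the field by integrating out `ω`. -/
theorem Condition1.measurable_covariance_abs [IsProbabilityMeasure P] (hd : 1 ≤ d)
    (h1 : Condition1 P Z C) :
    Measurable (Function.uncurry fun z τ : ℝ => C |z| |τ|) := by
  have h : (Function.uncurry fun z τ : ℝ => C |z| |τ|) = fun q : ℝ × ℝ =>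
      ∫ ω, Z (EuclideanSpace.single ⟨0, hd⟩ q.1, q.2) ω * Z (0, 0) ω ∂P := by
    ext q
    exact h1.covariance_abs_eq hd q.1 q.2
  have hs : Measurable fun z : ℝ => (EuclideanSpace.single ⟨0, hd⟩ z : Space d) := by
    have : (fun z : ℝ => (EuclideanSpace.single ⟨0, hd⟩ z : Space d)) =
        fun z => z • EuclideanSpace.single ⟨0, hd⟩ 1 := by
      ext z i
      simp
    rw [this]
    fun_prop
  rw [h]
  have hm : Measurable fun r : (ℝ × ℝ) × Ω =>
      Z (EuclideanSpace.single ⟨0, hd⟩ r.1.1, r.1.2) r.2 * Z (0, 0) r.2 :=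
    (h1.measurable.comp (((hs.comp (measurable_fst.comp measurable_fst)).prodMk
      (measurable_snd.comp measurable_fst)).prodMk measurable_snd)).mul
      ((h1.measurable_eval (0, 0)).comp measurable_snd)
  exact hm.stronglyMeasurable.integral_prod_right.measurable

theorem Condition1.covariance_abs_nonneg (hd : 1 ≤ d) (h1 : Condition1 P Z C) (z τ : ℝ) :
    0 ≤ C |z| |τ| := by
  rw [h1.covariance_abs_eq hd]
  exact h1.covariance_nonneg _ _ _ _

theorem Condition1.covariance_abs_le_one (hd : 1 ≤ d) (h1 : Condition1 P Z C) (z τ : ℝ) :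
    C |z| |τ| ≤ 1 := by
  rw [h1.covariance_abs_eq hd]
  refine (le_abs_self _).trans (abs_integral_le_integral_abs.trans ?_)
  exact integral_abs_mul_le (h1.measurable_eval _).aestronglyMeasurable
    (h1.measurable_eval _).aestronglyMeasurable (h1.integrable_sq _) (h1.integrable_sq _)
    (h1.unit_variance _).le (h1.unit_variance _).le

theorem Condition1.abs_covariance_abs_le_one (hd : 1 ≤ d) (h1 : Condition1 P Z C) (z τ : ℝ) :
    |(C |z| |τ|)| ≤ 1 := by
  rw [abs_of_nonneg (h1.covariance_abs_nonneg hd z τ)]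
  exact h1.covariance_abs_le_one hd z τ

theorem covIntegral_one_eq (K : Set (Space d)) (C : ℝ → ℝ → ℝ) {T : ℝ} (hT : 0 ≤ T) :
    covIntegral K C 1 T = ∫ τ in (0 : ℝ)..T, (1 - τ / T) *
      ∫ z in (0 : ℝ)..Metric.diam K, C |z| |τ| * distanceDensity K z := by
  refine intervalIntegral.integral_congr fun τ hτ => ?_
  rw [uIcc_of_le hT] at hτ
  simp only [mul_eq_mul_left_iff]
  left
  refine intervalIntegral.integral_congr fun z hz => ?_
  rw [uIcc_of_le Metric.diam_nonneg] at hz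
  simp only [abs_of_nonneg hz.1, abs_of_nonneg hτ.1, pow_one]

/-- The double integral of the covariance over the window is the variance `σ²`. -/
theorem Condition1.integral_covariance [IsProbabilityMeasure P] (hd : 1 ≤ d)
    (hK : IsConvexBody K) (h1 : Condition1 P Z C) {T : ℝ} (hT : 0 < T) :
    ∫ p : (Space d × ℝ) × (Space d × ℝ), C |‖p.1.1 - p.2.1‖| |(|p.1.2 - p.2.2|)|
        ∂((windowMeasure K T).prod (windowMeasure K T)) =
      2 * T * volume.real K ^ 2 * covIntegral K C 1 T := by
  rw [covIntegral_one_eq K C hT.le]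
  exact integral_windowMeasure_prod hd hK (h1.measurable_covariance_abs hd)
    (h1.abs_covariance_abs_le_one hd) hT

/-- The law of the space-time integral of the field. -/
theorem Condition1.map_integral_windowMeasure [IsProbabilityMeasure P] (hd : 1 ≤ d)
    (hK : IsConvexBody K) (h1 : Condition1 P Z C) {T : ℝ} (hT : 0 < T) :
    P.map (fun ω => ∫ p, Z p ω ∂(windowMeasure K T)) =
      gaussianReal 0 (2 * T * volume.real K ^ 2 * covIntegral K C 1 T).toNNReal := by
  have := hK.isFiniteMeasure_windowMeasure T
  rw [map_field_integral_eq_gaussianReal h1.measurable h1.gaussian h1.mean_zero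
    (fun p => (h1.unit_variance p).le), integral_sq_field_integral h1.measurable
    h1.integrable_sq (fun p => (h1.unit_variance p).le), ← h1.integral_covariance hd hK hT]
  simp only [h1.integral_mul_eq]

/-! ### Long-range dependence -/

/-- For `T ≥ 1` and `δ > 0`, dividing by `T ^ δ ≥ 1` only decreases a non-negative quantity. -/
theorem tendsto_covIntegral_atTop {m : ℕ} (h2 : Condition2 K C m) :
    Tendsto (fun T => covIntegral K C m T) atTop atTop := by
  obtain ⟨δ, hδ, h⟩ := h2.longRange
  refine tendsto_atTop_mono' atTop ?_ h
  filter_upwards [h.eventually_ge_atTop 0, eventually_ge_atTop 1] with T hT0 hT1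
  have hT : 1 ≤ T ^ δ := Real.one_le_rpow hT1 hδ.1.le
  have hc : 0 ≤ covIntegral K C m T := by
    by_contra hneg
    have : 1 / T ^ δ * covIntegral K C m T < 0 :=
      mul_neg_of_pos_of_neg (by positivity) (not_le.1 hneg)
    linarith
  have h3 : 1 / T ^ δ ≤ 1 := (div_le_one (by linarith)).2 hT
  nlinarith

/-- Controls the pairs with short time lag, where `C` need not be small. The distance density
integrates to one, leaving a one-dimensional integral at most `b`. -/
theorem integral_indicator_time_lag_le (hd : 1 ≤ d) (hK : IsConvexBody K) {T b : ℝ}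
    (hT : 0 < T) (hb : 0 ≤ b) :
    ∫ p : (Space d × ℝ) × (Space d × ℝ), (Iic b).indicator (1 : ℝ → ℝ) |p.1.2 - p.2.2|
        ∂((windowMeasure K T).prod (windowMeasure K T)) ≤ 2 * T * volume.real K ^ 2 * b := by
  have hm : Measurable ((Iic b).indicator (1 : ℝ → ℝ)) :=
    measurable_one.indicator measurableSet_Iic
  have hle (τ : ℝ) : |(Iic b).indicator (1 : ℝ → ℝ) τ| ≤ 1 := by
    by_cases h : τ ∈ Iic b <;> simp [h]
  have hnn (τ : ℝ) : 0 ≤ (Iic b).indicator (1 : ℝ → ℝ) τ :=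
    indicator_nonneg (fun _ _ => zero_le_one) τ
  rw [integral_windowMeasure_prod hd hK (f := fun _ τ => (Iic b).indicator (1 : ℝ → ℝ) τ)
    (hm.comp measurable_snd) (fun _ => hle) hT]
  refine mul_le_mul_of_nonneg_left ?_ (by positivity)
  have := hK.isProbabilityMeasure_distanceLaw
  have h1 (τ : ℝ) : ∫ z in (0 : ℝ)..Metric.diam K,
      (Iic b).indicator (1 : ℝ → ℝ) τ * distanceDensity K z = (Iic b).indicator 1 τ := by
    rw [← integral_distanceLaw hd hK fun _ => (Iic b).indicator (1 : ℝ → ℝ) τ]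
    simp
  simp only [h1]
  have hii := intervalIntegrable_of_bounded hm hle 0 T
  calc ∫ τ in (0 : ℝ)..T, (1 - τ / T) * (Iic b).indicator (1 : ℝ → ℝ) τ
      ≤ ∫ τ in (0 : ℝ)..T, (Iic b).indicator (1 : ℝ → ℝ) τ := by
        refine intervalIntegral.integral_mono_on hT.le
          (hii.continuousOn_mul (by fun_prop)) hii fun τ hτ => ?_
        have : 0 ≤ τ / T := div_nonneg hτ.1 hT.le
        nlinarith [hnn τ]
    _ = volume.real (Ioc 0 T ∩ Iic b) := by
        rw [intervalIntegral.integral_of_le hT.le, integral_indicator_one measurableSet_Iic,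
          measureReal_restrict_apply measurableSet_Iic, inter_comm]
    _ ≤ volume.real (Ioc 0 b) :=
        measureReal_mono (fun τ hτ => ⟨hτ.1.1, hτ.2⟩) (by simp)
    _ = b := by simp [hb]

/-- The squared covariance is of smaller order than the covariance. -/
theorem Condition1.integral_covariance_sq_le [IsProbabilityMeasure P] (hd : 1 ≤ d)
    (hK : IsConvexBody K) (h1 : Condition1 P Z C) {ε b : ℝ} (hb : 0 ≤ b)
    (hdecay : ∀ τ, b ≤ τ → ∀ z ∈ Icc 0 (Metric.diam K), |C z τ| ≤ ε) {T : ℝ} (hT : 0 < T) :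
    ∫ p : (Space d × ℝ) × (Space d × ℝ), C |‖p.1.1 - p.2.1‖| |(|p.1.2 - p.2.2|)| ^ 2
        ∂((windowMeasure K T).prod (windowMeasure K T)) ≤
      2 * T * volume.real K ^ 2 * (ε * covIntegral K C 1 T + b) := by
  have := hK.isFiniteMeasure_windowMeasure T
  have hCm : Measurable fun p : (Space d × ℝ) × (Space d × ℝ) =>
      C |‖p.1.1 - p.2.1‖| |(|p.1.2 - p.2.2|)| :=
    (h1.measurable_covariance_abs hd).comp
      (f := fun p : (Space d × ℝ) × (Space d × ℝ) => (‖p.1.1 - p.2.1‖, |p.1.2 - p.2.2|))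
      (by fun_prop)
  have hC0 (p : (Space d × ℝ) × (Space d × ℝ)) :=
    h1.covariance_abs_nonneg hd ‖p.1.1 - p.2.1‖ |p.1.2 - p.2.2|
  have hC1 (p : (Space d × ℝ) × (Space d × ℝ)) :=
    h1.covariance_abs_le_one hd ‖p.1.1 - p.2.1‖ |p.1.2 - p.2.2|
  have hCint : Integrable (fun p : (Space d × ℝ) × (Space d × ℝ) =>
      C |‖p.1.1 - p.2.1‖| |(|p.1.2 - p.2.2|)|)
      ((windowMeasure K T).prod (windowMeasure K T)) :=
    .of_bound hCm.aestronglyMeasurable 1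
      (ae_of_all _ fun p => h1.abs_covariance_abs_le_one hd _ _)
  have hC2int : Integrable (fun p : (Space d × ℝ) × (Space d × ℝ) =>
      C |‖p.1.1 - p.2.1‖| |(|p.1.2 - p.2.2|)| ^ 2)
      ((windowMeasure K T).prod (windowMeasure K T)) := by
    refine .of_bound (hCm.pow_const 2).aestronglyMeasurable 1 (ae_of_all _ fun p => ?_)
    rw [Real.norm_of_nonneg (sq_nonneg _)]
    exact pow_le_one₀ (hC0 p) (hC1 p)
  have hIint : Integrable (fun p : (Space d × ℝ) × (Space d × ℝ) =>
      (Iic b).indicator (1 : ℝ → ℝ) |p.1.2 - p.2.2|)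
      ((windowMeasure K T).prod (windowMeasure K T)) := by
    refine .of_bound (((measurable_one.indicator measurableSet_Iic).comp
      (by fun_prop : Measurable fun p : (Space d × ℝ) × (Space d × ℝ) =>
        |p.1.2 - p.2.2|)).aestronglyMeasurable) 1 (ae_of_all _ fun p => ?_)
    by_cases h : |p.1.2 - p.2.2| ∈ Iic b <;> simp [h]
  -- Pointwise `C² ≤ ε C + 1_{lag ≤ b}`: decay handles long lags, `C ≤ 1` the short ones.
  have hle : ∫ p : (Space d × ℝ) × (Space d × ℝ), C |‖p.1.1 - p.2.1‖| |(|p.1.2 - p.2.2|)| ^ 2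
        ∂((windowMeasure K T).prod (windowMeasure K T)) ≤
      ∫ p : (Space d × ℝ) × (Space d × ℝ), (ε * C |‖p.1.1 - p.2.1‖| |(|p.1.2 - p.2.2|)| +
        (Iic b).indicator (1 : ℝ → ℝ) |p.1.2 - p.2.2|)
        ∂((windowMeasure K T).prod (windowMeasure K T)) := by
    refine integral_mono_ae hC2int ((hCint.const_mul ε).add hIint) ?_
    filter_upwards [ae_windowMeasure_prod_mem hK T] with p hp
    have hz : ‖p.1.1 - p.2.1‖ ∈ Icc 0 (Metric.diam K) := by
      refine ⟨norm_nonneg _, ?_⟩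
      rw [← dist_eq_norm]
      exact Metric.dist_le_diam_of_mem hK.isCompact.isBounded hp.1 hp.2
    have hε : 0 ≤ ε := (abs_nonneg _).trans (hdecay b le_rfl _ hz)
    rcases le_total b |p.1.2 - p.2.2| with hbt | hbt
    · have h3 := hdecay _ hbt _ hz
      have h4 : C |‖p.1.1 - p.2.1‖| |(|p.1.2 - p.2.2|)| ≤ ε := by
        rw [abs_norm, abs_abs]
        exact (le_abs_self _).trans h3
      have h5 : 0 ≤ (Iic b).indicator (1 : ℝ → ℝ) |p.1.2 - p.2.2| :=
        indicator_nonneg (fun _ _ => zero_le_one) _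
      nlinarith [hC0 p]
    · rw [indicator_of_mem (mem_Iic.2 hbt), Pi.one_apply]
      nlinarith [hC0 p, hC1 p, mul_nonneg hε (hC0 p)]
  refine hle.trans ?_
  rw [integral_add (hCint.const_mul ε) hIint, integral_const_mul,
    h1.integral_covariance hd hK hT]
  have := integral_indicator_time_lag_le hd hK hT hb
  linarith

theorem exists_decay_bound [IsProbabilityMeasure P] (hd : 1 ≤ d) (h1 : Condition1 P Z C)
    {m : ℕ} (h2 : Condition2 K C m) {ε : ℝ} (hε : 0 < ε) :
    ∃ b, 0 ≤ b ∧ ∀ τ, b ≤ τ → ∀ z ∈ Icc 0 (Metric.diam K), |C z τ| ≤ ε := by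
  obtain ⟨b, hb⟩ := eventually_atTop.1 (h2.decay.eventually (gt_mem_nhds hε))
  refine ⟨max b 0, le_max_right _ _, fun τ hτ z hz => ?_⟩
  have hτ0 : 0 ≤ τ := (le_max_right _ _).trans hτ
  refine le_trans ?_ (hb τ ((le_max_left _ _).trans hτ)).le
  -- `sSup` bounds the values only for a set bounded above; the bound is `|C| ≤ 1`, available since
  -- `max b 0` forces `τ ≥ 0`.
  refine le_csSup ⟨1, ?_⟩ (mem_image_of_mem _ hz)
  rintro _ ⟨w, hw, rfl⟩
  have := h1.abs_covariance_abs_le_one hd w τ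
  rwa [abs_of_nonneg hw.1, abs_of_nonneg hτ0] at this

/-! ### The remainder -/

theorem Condition1.map_eval [IsProbabilityMeasure P] (h1 : Condition1 P Z C)
    (p : Space d × ℝ) : P.map (Z p) = gaussianReal 0 1 :=
  map_eq_gaussianReal_zero_one (h1.gaussian.hasGaussianLaw_eval p) (h1.mean_zero p)
    (h1.unit_variance p)

theorem Condition1.measurable_remainder (h1 : Condition1 P Z C) (u : ℝ) :
    Measurable fun q : (Space d × ℝ) × Ω => excursionRemainder u (Z q.1 q.2) :=
  (measurable_excursionRemainder u).comp h1.measurable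

theorem Condition1.integrable_sq_remainder [IsProbabilityMeasure P] (h1 : Condition1 P Z C)
    (u : ℝ) (p : Space d × ℝ) : Integrable (fun ω => excursionRemainder u (Z p ω) ^ 2) P :=
  (integrable_sq_excursionRemainder (h1.map_eval p) (h1.measurable_eval p).aemeasurable u).1

theorem Condition1.integral_sq_remainder_le [IsProbabilityMeasure P] (h1 : Condition1 P Z C)
    (u : ℝ) (p : Space d × ℝ) :
    ∫ ω, excursionRemainder u (Z p ω) ^ 2 ∂P ≤ ∫ x, (1 + |x|) ^ 2 ∂(gaussianReal 0 1) :=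
  (integrable_sq_excursionRemainder (h1.map_eval p) (h1.measurable_eval p).aemeasurable u).2

/-- The two-point estimate, integrated over all pairs of window points. -/
theorem Condition1.integral_sq_integral_remainder_le [IsProbabilityMeasure P] (hd : 1 ≤ d)
    (hK : IsConvexBody K) (h1 : Condition1 P Z C) (u T : ℝ) :
    ∫ ω, (∫ p, excursionRemainder u (Z p ω) ∂(windowMeasure K T)) ^ 2 ∂P ≤
      remainderConst u *
        ∫ p : (Space d × ℝ) × (Space d × ℝ), C |‖p.1.1 - p.2.1‖| |(|p.1.2 - p.2.2|)| ^ 2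
          ∂((windowMeasure K T).prod (windowMeasure K T)) := by
  have := hK.isFiniteMeasure_windowMeasure T
  rw [integral_sq_field_integral (F := fun p ω => excursionRemainder u (Z p ω))
    (h1.measurable_remainder u) (h1.integrable_sq_remainder u) (h1.integral_sq_remainder_le u),
    ← integral_const_mul]
  refine integral_mono
    (integrable_field_mul (F := fun p ω => excursionRemainder u (Z p ω))
      (h1.measurable_remainder u) (h1.integrable_sq_remainder u)
      (h1.integral_sq_remainder_le u)).integral_prod_left ?_ fun p => ?_
  · refine Integrable.const_mul ?_ _
    have hm : Measurable fun p : (Space d × ℝ) × (Space d × ℝ) =>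
        C |‖p.1.1 - p.2.1‖| |(|p.1.2 - p.2.2|)| :=
      (h1.measurable_covariance_abs hd).comp
        (f := fun p : (Space d × ℝ) × (Space d × ℝ) => (‖p.1.1 - p.2.1‖, |p.1.2 - p.2.2|))
        (by fun_prop)
    refine .of_bound (hm.pow_const 2).aestronglyMeasurable 1 (ae_of_all _ fun p => ?_)
    rw [Real.norm_of_nonneg (sq_nonneg _)]
    exact pow_le_one₀ (h1.covariance_abs_nonneg hd _ _) (h1.covariance_abs_le_one hd _ _)
  · have h := abs_integral_excursionRemainder_mul_le (h1.gaussian.hasGaussianLaw_prodMk)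
      (h1.mean_zero p.1) (h1.unit_variance p.1) (h1.mean_zero p.2) (h1.unit_variance p.2)
      (h1.covariance_nonneg _ _ _ _) u
    rw [h1.integral_mul_eq] at h
    exact (le_abs_self _).trans h

theorem Condition1.integrable_windowMeasure_ae [IsProbabilityMeasure P]
    (hK : IsConvexBody K) (h1 : Condition1 P Z C) (T : ℝ) :
    ∀ᵐ ω ∂P, Integrable (fun p => Z p ω) (windowMeasure K T) := by
  have := hK.isFiniteMeasure_windowMeasure T
  exact (integrable_field (μ := windowMeasure K T) h1.measurable h1.integrable_sq
    (fun p => (h1.unit_variance p).le)).prod_left_ae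

theorem intervalIntegral_eq_integral_windowMeasure (hK : IsConvexBody K) {T : ℝ} (hT : 0 ≤ T)
    {f : Space d × ℝ → ℝ} (hf : Integrable f (windowMeasure K T)) :
    ∫ t in (0 : ℝ)..T, ∫ x in K, f (x, t) = ∫ p, f p ∂(windowMeasure K T) := by
  have : IsFiniteMeasure (volume.restrict K) := ⟨by
    rw [Measure.restrict_apply_univ]; exact hK.volume_ne_top.lt_top⟩
  rw [intervalIntegral.integral_of_le hT, ← integral_Icc_eq_integral_Ioc]
  exact (integral_prod_symm f hf).symm

theorem Condition1.excursionVolume_eq (h1 : Condition1 P Z C)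
    (u T : ℝ) (ω : Ω) :
    excursionVolume Z K u T ω =
      ∫ p, (Ici u).indicator (1 : ℝ → ℝ) (Z p ω) ∂(windowMeasure K T) := by
  have hm : Measurable fun p => Z p ω := h1.measurable.comp (measurable_id.prodMk measurable_const)
  have hs : MeasurableSet {p | u ≤ Z p ω} := measurableSet_le measurable_const hm
  have h : (fun p => (Ici u).indicator (1 : ℝ → ℝ) (Z p ω)) = {p | u ≤ Z p ω}.indicator 1 := by
    ext p
    simp [indicator]
  rw [h, integral_indicator_one hs, windowMeasure_eq_restrict, measureReal_restrict_apply hs,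
    excursionVolume]
  congr 1
  ext p
  simp only [mem_ofPred_eq, mem_inter_iff, mem_prod, mem_Icc]
  tauto

/-- Chaos decomposition of the sojourn functional up to order one. -/
theorem Condition1.excursionVolume_sub_eq (hK : IsConvexBody K) (h1 : Condition1 P Z C)
    (u : ℝ) {T : ℝ} (hT : 0 ≤ T) {ω : Ω} (hω : Integrable (fun p => Z p ω) (windowMeasure K T)) :
    excursionVolume Z K u T ω - T * volume.real K * (1 - cdf (gaussianReal 0 1) u) =
      gaussianPDFReal 0 1 u * ∫ p, Z p ω ∂(windowMeasure K T) +
        ∫ p, excursionRemainder u (Z p ω) ∂(windowMeasure K T) := by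
  have := hK.isFiniteMeasure_windowMeasure T
  have hm : Measurable fun p => Z p ω := h1.measurable.comp (measurable_id.prodMk measurable_const)
  have hi : Integrable (fun p => (Ici u).indicator (1 : ℝ → ℝ) (Z p ω)) (windowMeasure K T) := by
    refine .of_bound (((measurable_one.indicator measurableSet_Ici).comp
      hm).aestronglyMeasurable) 1 (ae_of_all _ fun p => ?_)
    by_cases h : Z p ω ∈ Ici u <;> simp [h]
  have hi2 : Integrable (fun p => (Ici u).indicator (1 : ℝ → ℝ) (Z p ω) -
      (1 - cdf (gaussianReal 0 1) u)) (windowMeasure K T) := hi.sub (integrable_const _)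
  unfold excursionRemainder
  rw [integral_sub hi2 (hω.const_mul _), integral_sub hi (integrable_const _),
    ← h1.excursionVolume_eq, integral_const_mul, integral_const, windowMeasure_real_univ K hT,
    smul_eq_mul]
  ring

/-! ### Normalized functionals and their limits -/

theorem Condition1.measurable_normalizedExcursion (hK : IsConvexBody K)
    (h1 : Condition1 P Z C) (u T : ℝ) : Measurable (normalizedExcursion Z K C u T) := by
  have hs : MeasurableSet {q : (Space d × ℝ) × Ω |
      q.1.1 ∈ K ∧ 0 ≤ q.1.2 ∧ q.1.2 ≤ T ∧ u ≤ Z q.1 q.2} := by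
    have hK' := hK.isCompact.isClosed.measurableSet
    have ht : Measurable fun q : (Space d × ℝ) × Ω => q.1.2 := by fun_prop
    exact ((measurable_fst.comp measurable_fst) hK').inter
      ((measurableSet_le measurable_const ht).inter
        ((measurableSet_le ht measurable_const).inter
          (measurableSet_le measurable_const h1.measurable)))
  have hv : Measurable (excursionVolume Z K u T) :=
    (measurable_measure_prodMk_right (μ := (volume : Measure (Space d × ℝ))) hs).ennreal_toReal
  exact (hv.sub_const _).div_const _

theorem Condition1.measurable_normalizedIntegral (hK : IsConvexBody K)
    (h1 : Condition1 P Z C) (T : ℝ) : Measurable (normalizedIntegral Z K C T) := by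
  have : IsFiniteMeasure (volume.restrict K) := ⟨by
    rw [Measure.restrict_apply_univ]; exact hK.volume_ne_top.lt_top⟩
  have hinner : StronglyMeasurable fun r : Ω × ℝ => ∫ x in K, Z (x, r.2) r.1 := by
    have hm : Measurable fun q : (Ω × ℝ) × Space d => Z (q.2, q.1.2) q.1.1 :=
      h1.measurable.comp (by fun_prop :
        Measurable fun q : (Ω × ℝ) × Space d => ((q.2, q.1.2), q.1.1))
    exact hm.stronglyMeasurable.integral_prod_right
  have houter (s : Set ℝ) : Measurable fun ω => ∫ t in s, ∫ x in K, Z (x, t) ω :=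
    (hinner.integral_prod_right (ν := volume.restrict s)).measurable
  refine Measurable.div_const ?_ _
  -- An interval integral is a difference of two set integrals, so this covers negative `T` as well.
  exact (houter _).sub (houter _)

theorem sigmaOne_pos (hK : IsConvexBody K) {T : ℝ} (hT : 0 < T)
    (hc : 0 < covIntegral K C 1 T) : 0 < sigmaOne K C T := by
  have := hK.volume_real_pos
  exact Real.sqrt_pos.2 (by positivity)

theorem sigmaOne_sq (hK : IsConvexBody K) {T : ℝ} (hT : 0 < T)
    (hc : 0 < covIntegral K C 1 T) :
    sigmaOne K C T ^ 2 = 2 * T * volume.real K ^ 2 * covIntegral K C 1 T := by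
  have := hK.volume_real_pos
  exact Real.sq_sqrt (by positivity)

/-- The normalized integral is exactly standard normal as soon as its variance is positive. -/
theorem Condition1.map_normalizedIntegral [IsProbabilityMeasure P] (hd : 1 ≤ d)
    (hK : IsConvexBody K) (h1 : Condition1 P Z C) {T : ℝ} (hT : 0 < T)
    (hc : 0 < covIntegral K C 1 T) :
    P.map (normalizedIntegral Z K C T) = gaussianReal 0 1 := by
  have hfin := hK.isFiniteMeasure_windowMeasure T
  have hae : normalizedIntegral Z K C T =ᵐ[P]
      fun ω => (∫ p, Z p ω ∂(windowMeasure K T)) / sigmaOne K C T := by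
    filter_upwards [h1.integrable_windowMeasure_ae hK T] with ω hω
    rw [normalizedIntegral, intervalIntegral_eq_integral_windowMeasure hK hT.le hω]
  have hσ := sigmaOne_pos hK hT hc
  have hσ2 := sigmaOne_sq hK hT hc
  rw [Measure.map_congr hae]
  have hmap := Measure.map_map (μ := P) (measurable_id.div_const (sigmaOne K C T))
    (measurable_field_integral (μ := windowMeasure K T) h1.measurable)
  rw [h1.map_integral_windowMeasure hd hK hT] at hmap
  have hcomp : (fun ω => (∫ p, Z p ω ∂(windowMeasure K T)) / sigmaOne K C T) =
      (fun x : ℝ => id x / sigmaOne K C T) ∘ fun ω => ∫ p, Z p ω ∂(windowMeasure K T) := rfl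
  rw [hcomp, ← hmap]
  simp only [id_eq]
  rw [gaussianReal_map_div_const, zero_div]
  congr 1
  ext
  rw [NNReal.coe_div, NNReal.coe_mk, Real.coe_toNNReal _ (by rw [← hσ2]; positivity), ← hσ2,
    NNReal.coe_one, div_self (by positivity)]

theorem Condition1.tendsto_integral_sq_remainder_div [IsProbabilityMeasure P] (hd : 1 ≤ d)
    (hK : IsConvexBody K) (h1 : Condition1 P Z C) (h2 : Condition2 K C 1) (u : ℝ) :
    Tendsto (fun T => (∫ ω, (∫ p, excursionRemainder u (Z p ω) ∂(windowMeasure K T)) ^ 2 ∂P) /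
      sigmaOne K C T ^ 2) atTop (𝓝 0) := by
  have hM : 0 ≤ remainderConst u := by
    unfold remainderConst
    have hA : 0 ≤ ∫ x, (1 + |x|) * remainderBound u x ∂(gaussianReal 0 1) :=
      integral_nonneg fun x => mul_nonneg (by positivity) (remainderBound_nonneg u x)
    have hB : 0 ≤ ∫ x, (1 + |x|) ^ 2 ∂(gaussianReal 0 1) :=
      integral_nonneg fun x => by positivity
    linarith
  have hcov := tendsto_covIntegral_atTop h2
  rw [Metric.tendsto_atTop']
  intro ε hε
  -- The final bound is `2 * remainderConst u * η` times `σ²`; the added 1 keeps the denominator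
  -- positive if the constant vanishes.
  set η := ε / (3 * (remainderConst u + 1)) with hη
  have hη0 : 0 < η := by positivity
  obtain ⟨b, hb, hdecay⟩ := exists_decay_bound hd h1 h2 hη0
  have hev : ∀ᶠ T in atTop, 0 < T ∧ 0 < covIntegral K C 1 T ∧ b ≤ η * covIntegral K C 1 T := by
    filter_upwards [eventually_gt_atTop 0, hcov.eventually_gt_atTop 0,
      hcov.eventually_ge_atTop (b / η)] with T hT hc hcb
    refine ⟨hT, hc, ?_⟩
    rwa [div_le_iff₀ hη0, mul_comm] at hcb
  obtain ⟨N, hN⟩ := eventually_atTop.1 hev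
  refine ⟨N, fun T hTN => ?_⟩
  obtain ⟨hT, hc, hcb⟩ := hN T hTN.le
  have hσ := sigmaOne_pos hK hT hc
  have hσ2 := sigmaOne_sq hK hT hc
  have hV := hK.volume_real_pos
  rw [Real.dist_eq, sub_zero, abs_of_nonneg (div_nonneg (integral_nonneg fun _ => sq_nonneg _)
    (sq_nonneg _)), div_lt_iff₀ (by positivity)]
  calc _ ≤ remainderConst u * (2 * T * volume.real K ^ 2 * (η * covIntegral K C 1 T + b)) :=
        (h1.integral_sq_integral_remainder_le hd hK u T).trans
          (mul_le_mul_of_nonneg_left (h1.integral_covariance_sq_le hd hK hb hdecay hT) hM)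
    _ ≤ remainderConst u * (2 * T * volume.real K ^ 2 *
          (η * covIntegral K C 1 T + η * covIntegral K C 1 T)) := by gcongr
    _ = (2 * remainderConst u * η) * sigmaOne K C T ^ 2 := by rw [hσ2]; ring
    _ < ε * sigmaOne K C T ^ 2 := by
        refine mul_lt_mul_of_pos_right ?_ (by positivity)
        rw [hη]
        field_simp
        nlinarith

/-- The difference is almost surely the integrated remainder divided by `φ(u) σ`, whose `L²` norm
tends to zero. -/
theorem Condition1.tendstoInMeasure_normalized_sub [IsProbabilityMeasure P] (hd : 1 ≤ d)
    (hK : IsConvexBody K) (h1 : Condition1 P Z C) (h2 : Condition2 K C 1) (u : ℝ) :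
    TendstoInMeasure P ((fun T => normalizedExcursion Z K C u T) -
      fun T => normalizedIntegral Z K C T) atTop 0 := by
  refine tendstoInMeasure_of_tendsto_eLpNorm (p := 2) two_ne_zero (fun T =>
    ((h1.measurable_normalizedExcursion hK u T).sub
      (h1.measurable_normalizedIntegral hK T)).aestronglyMeasurable)
    aestronglyMeasurable_zero ?_
  have hφ : 0 < gaussianPDFReal 0 1 u := gaussianPDFReal_pos _ _ _ one_ne_zero
  have hlim := (h1.tendsto_integral_sq_remainder_div hd hK h2 u).const_mul
    ((gaussianPDFReal 0 1 u ^ 2)⁻¹)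
  rw [mul_zero] at hlim
  have hlim2 := ENNReal.tendsto_ofReal (hlim.sqrt)
  rw [Real.sqrt_zero, ENNReal.ofReal_zero] at hlim2
  refine hlim2.congr' ?_
  filter_upwards [eventually_gt_atTop 0,
    (tendsto_covIntegral_atTop h2).eventually_gt_atTop 0] with T hT hc
  have hfin := hK.isFiniteMeasure_windowMeasure T
  have hσ := sigmaOne_pos hK hT hc
  have hae : ((fun T => normalizedExcursion Z K C u T) - fun T => normalizedIntegral Z K C T) T -
      0 =ᵐ[P] fun ω => (gaussianPDFReal 0 1 u * sigmaOne K C T)⁻¹ *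
        ∫ p, excursionRemainder u (Z p ω) ∂(windowMeasure K T) := by
    filter_upwards [h1.integrable_windowMeasure_ae hK T] with ω hω
    simp only [Pi.sub_apply, Pi.zero_apply, sub_zero]
    rw [normalizedExcursion, normalizedIntegral, h1.excursionVolume_sub_eq hK u hT.le hω,
      intervalIntegral_eq_integral_windowMeasure hK hT.le hω]
    field_simp
    ring
  have hmeas : AEStronglyMeasurable (fun ω => (gaussianPDFReal 0 1 u * sigmaOne K C T)⁻¹ *
      ∫ p, excursionRemainder u (Z p ω) ∂(windowMeasure K T)) P :=
    ((measurable_field_integral (F := fun p ω => excursionRemainder u (Z p ω))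
      (μ := windowMeasure K T) (h1.measurable_remainder u)).const_mul _).aestronglyMeasurable
  have hLp : MemLp (fun ω => (gaussianPDFReal 0 1 u * sigmaOne K C T)⁻¹ *
      ∫ p, excursionRemainder u (Z p ω) ∂(windowMeasure K T)) 2 P := by
    rw [memLp_two_iff_integrable_sq hmeas]
    simp only [mul_pow]
    exact (integrable_sq_field_integral (F := fun p ω => excursionRemainder u (Z p ω))
      (h1.measurable_remainder u) (h1.integrable_sq_remainder u)
      (h1.integral_sq_remainder_le u)).const_mul _
  rw [eLpNorm_congr_ae hae, hLp.eLpNorm_eq_integral_rpow_norm two_ne_zero (by norm_num)]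
  congr 1
  rw [Real.sqrt_eq_rpow]
  simp only [ENNReal.toReal_ofNat, Real.rpow_two, Real.norm_eq_abs, sq_abs, mul_pow]
  rw [integral_const_mul, one_div]
  congr 1
  field_simp

end LimitTheorem

end SpaceTimeField

end

theorem theorem2 {d : ℕ} (hd : 1 ≤ d)
    {Ω : Type*} [MeasurableSpace Ω] (P : Measure Ω) [IsProbabilityMeasure P]
    (Z : SpaceTimeField.Space d × ℝ → Ω → ℝ) (C : ℝ → ℝ → ℝ)
    (K : Set (SpaceTimeField.Space d)) (hK : SpaceTimeField.IsConvexBody K)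
    (h1 : SpaceTimeField.Condition1 P Z C)
    (h2 : SpaceTimeField.Condition2 K C 1) (u : ℝ) :
    TendstoInDistribution (fun T : ℝ => SpaceTimeField.normalizedExcursion Z K C u T)
        atTop (id : ℝ → ℝ) (fun _ => P) (gaussianReal 0 1) ∧
      TendstoInDistribution (fun T : ℝ => SpaceTimeField.normalizedIntegral Z K C T)
        atTop (id : ℝ → ℝ) (fun _ => P) (gaussianReal 0 1) := by
  have hint : TendstoInDistribution (fun T : ℝ => SpaceTimeField.normalizedIntegral Z K C T)
      atTop (id : ℝ → ℝ) (fun _ => P) (gaussianReal 0 1) := by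
    refine ⟨fun T => (h1.measurable_normalizedIntegral hK T).aemeasurable, aemeasurable_id, ?_⟩
    -- The laws are eventually equal to the limit, so no genuine convergence is involved here.
    refine tendsto_const_nhds.congr' ?_
    filter_upwards [eventually_gt_atTop 0,
      (SpaceTimeField.tendsto_covIntegral_atTop h2).eventually_gt_atTop 0] with T hT hc
    apply Subtype.ext
    simp only [Measure.map_id]
    exact (h1.map_normalizedIntegral hd hK hT hc).symm
  exact ⟨tendstoInDistribution_of_tendstoInMeasure_sub _ _ hint
    (h1.tendstoInMeasure_normalized_sub hd hK h2 u)
    fun T => (h1.measurable_normalizedExcursion hK u T).aemeasurable, hint⟩
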